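/- Conventions. A stream is a finite sequence $S=((d_1,\delta_1),\dots,(d_N,\delta_N))$ with $d_i\in[n]$, $\delta_i\in\mathbb Z$ (turnstile model); it is insertion-only if all $\delta_i=1$. Put $f^{(k)}_d=\sum_{j\le k,\,d_j=d}\delta_j$, let $f=f^{(N)}$ be its frequency vector, $\operatorname{supp}(f)=\{d:f_d\ne0\}$, and $M=M(S)=\max\{n,|f^{(k)}_d|:d\in[n],0\le k\le N\}$. A function $g:\mathbb N\to\mathbb R$ is called decreasing if it is nonnegative and nonincreasing on $\{1,2,\dots\}$; $g(f)=\sum_{d\in\operatorname{supp}(f)}g(|f_d|)$; and $$\sigma(\varepsilon,g,m,n)=\max\Big\{|\operatorname{supp}(f)|: f\in\mathbb N^n,\ \textstyle\sum_d f_d\le m,\ g(f)\le\varepsilon^{-1}g(1)\Big\}.$$ A streaming algorithm (for given parameters) keeps a string of bits as its memory: the initial memory is set from finitely many fair coin flips, the memory is updated on reading each update (as a function of the memory and the update), and the output is a function of the final memory; random bits that are used later have to be kept in the memory. The space used on $S$ is the maximal number of bits in the memory, over all coin flips and all times $0\le k\le N$. The evaluation of $g$ on the output of a sketch is not counted. Theorem.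 There is an absolute constant $C>0$ such that the following holds for all integers $2\le n\le m$. For each real $r$ there is a streaming algorithm (sketch) $A_r$, depending only on $n$, $m$, $r$, whose output is a number $q$ and a vector $w\in\mathbb Z^n$, such that for every decreasing $g$ and every $0<\varepsilon\le1$, with $\sigma=\sigma(\varepsilon,g,m,n)$ and $r=\sigma/\varepsilon$: (1) (Space.) On every turnstile stream with $\sum_d|f_d|\le m$, $A_r$ uses at most $C\,\varepsilon^{-1}\sigma\,\log^2(n)\,\log(M)$ bits. (2) (Approximation.) On every such stream, with probability at least $2/3$, $(1-\varepsilon)g(f)\le q^{-1}\sum_{d:\,w_d\ne0}g(|w_d|)\le(1+\varepsilon)g(f)$. (3) (Sampling.) For some $\ell$, the coin flips of $A_r$ determine, for each $i\le\ell$, pairwise independent Bernoulli$(2^{-i})$ variables $X_{i,d}$, $d\in[n]$, such that on every such stream, with probability at least $7/9$, there is $i\le\ell$ with $q=2^{-i}$, $w_d=X_{i,d}f_d$ for all $d\in[n]$, and $\min\{|\operatorname{supp}(f)|,\,9\sigma/\varepsilon\}\le q\,|\operatorname{supp}(f)|\le C\,\sigma/\varepsilon$. (4) (Universality.) The same $A_r$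 is universal: for every decreasing $g'$ and $0<\varepsilon'\le1$ with $\sigma(\varepsilon',g',m,n)/\varepsilon'\le\sigma/\varepsilon$, on every such stream, with probability at least $2/3$, $(1-\varepsilon')g'(f)\le q^{-1}\sum_{d:\,w_d\ne0}g'(|w_d|)\le(1+\varepsilon')g'(f)$. The same holds for insertion-only streams with $\sum_d|f_d|\le m$ (with another family of sketches), with the space bound in (1) replaced by $C\,(\varepsilon^{-1}\sigma\log(M)+\log^2 n)$ bits. -/

import Mathlib

/-! ### Decreasing functions, streaming sums and the parameter `sigma` -/

/-- Nonnegative and nonincreasing on the positive integers.  The value at `0` is irrelevant, since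
all sums below range over supports only. -/
def IsDecreasingFn (g : ℕ → ℝ) : Prop :=
  (∀ x, 1 ≤ x → 0 ≤ g x) ∧ ∀ x y, 1 ≤ x → x ≤ y → g y ≤ g x

/-- The support of a vector. -/
def vsupp {n : ℕ} (f : Fin n → ℕ) : Finset (Fin n) :=
  Finset.univ.filter fun d => f d ≠ 0

/-- The streaming sum `g(f) = ∑_{d ∈ supp f} g(f_d)`. -/
def gsum {n : ℕ} (g : ℕ → ℝ) (f : Fin n → ℕ) : ℝ :=
  ∑ d ∈ vsupp f, g (f d)

/-- Vectors of natural numbers of dimension `n` and `L¹` norm at most `m`. -/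
def freqVectors (n m : ℕ) : Set (Fin n → ℕ) :=
  {f | ∑ d, f d ≤ m}

/-- `σ(ε, g, m, n)`, the largest support size of a vector `f` of `L¹` norm at most `m` that
satisfies `g(f) ≤ ε⁻¹ g(1)`.  The set is bounded by `n`, so this supremum is a maximum. -/
noncomputable def sigma (ε : ℝ) (g : ℕ → ℝ) (m n : ℕ) : ℕ :=
  sSup {k | ∃ f ∈ freqVectors n m, gsum g f ≤ ε⁻¹ * g 1 ∧ (vsupp f).card = k}

/-! ### Streams -/

/-- A stream over the items `Fin n`: a finite sequence of updates `(d, δ)`. -/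
abbrev UpdateStream (n : ℕ) : Type := List (Fin n × ℤ)

/-- The frequency of the item `d` after all the updates of `S`. -/
def freq {n : ℕ} (S : UpdateStream n) (d : Fin n) : ℤ :=
  (S.map fun u => if u.1 = d then u.2 else 0).sum

/-- The vector of absolute frequencies `|f|`. -/
def absFreq {n : ℕ} (S : UpdateStream n) (d : Fin n) : ℕ := (freq S d).natAbs

/-- `M = max {n, |f_d^{(k)}| : d ∈ [n], 0 ≤ k ≤ N}`. -/
def maxFreq {n : ℕ} (S : UpdateStream n) : ℕ :=
  max n ((Finset.range (S.length + 1)).sup fun k =>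
    Finset.univ.sup fun d => absFreq (S.take k) d)

/-- Turnstile streams whose final frequency vector has `L¹` norm at most `m`. -/
def turnstileStreams (n m : ℕ) : Set (UpdateStream n) :=
  {S | absFreq S ∈ freqVectors n m}

/-- Insertion-only streams (`δ = 1` in all updates) whose frequency vector has `L¹` norm at
most `m`. -/
def insertionStreams (n m : ℕ) : Set (UpdateStream n) :=
  {S | absFreq S ∈ freqVectors n m ∧ ∀ u ∈ S, u.2 = 1}

/-! ### Randomized one-pass streaming algorithms and their storage -/

/-- A randomized one-pass streaming algorithm over the items `Fin n` with outputs in `O`.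
Its memory is a string of bits.  It flips `coins` fair coins, from which it sets up its initial
memory; then it reads the updates one at a time, each time replacing its memory by a function of
the memory and the update; its output is a function of the final memory.  Random bits are
available later only if they are kept in the memory, where they count as storage. -/
structure StreamAlg (n : ℕ) (O : Type) where
  coins : ℕ
  init : (Fin coins → Bool) → List Bool
  step : List Bool → Fin n × ℤ → List Bool
  output : List Bool → O

namespace StreamAlg

variable {n : ℕ} {O : Type}

/-- The outcomes of the coin flips of an algorithm. -/
abbrev Coins (A : StreamAlg n O) : Type := Fin A.coins → Bool

/-- The memory after reading the stream `S`, with coin flips `ω`. -/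
def memory (A : StreamAlg n O) (ω : A.Coins) (S : UpdateStream n) : List Bool :=
  S.foldl A.step (A.init ω)

/-- The output on the stream `S`, with coin flips `ω`. -/
def result (A : StreamAlg n O) (ω : A.Coins) (S : UpdateStream n) : O :=
  A.output (A.memory ω S)

/-- The storage used on the stream `S`: the maximal number of bits in the memory, over all the
outcomes of the coin flips and all times `0 ≤ k ≤ N`. -/
def storage (A : StreamAlg n O) (S : UpdateStream n) : ℕ :=
  Finset.univ.sup fun ω : A.Coins =>
    (Finset.range (S.length + 1)).sup fun k => (A.memory ω (S.take k)).length

open Classical in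
/-- The probability of an event under fair coin flips. -/
noncomputable def prob (A : StreamAlg n O) (E : A.Coins → Prop) : ℝ :=
  ((Finset.univ.filter E).card : ℝ) / 2 ^ A.coins

/-- Post-processing of the output, in the same memory. -/
def mapOutput {O' : Type} (A : StreamAlg n O) (φ : O → O') : StreamAlg n O' where
  coins := A.coins
  init := A.init
  step := A.step
  output := fun x => φ (A.output x)

end StreamAlg

/-- `A` is a `(1 ± ε)`-approximation algorithm for `g(f)` on the given streams. -/
def IsApproxAlg {n : ℕ} (A : StreamAlg n ℝ) (g : ℕ → ℝ) (ε : ℝ) (streams : Set (UpdateStream n)) :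
    Prop :=
  ∀ S ∈ streams,
    2 / 3 ≤ A.prob fun ω =>
      (1 - ε) * gsum g (absFreq S) ≤ A.result ω S ∧
        A.result ω S ≤ (1 + ε) * gsum g (absFreq S)

/-! ### Sampling sketches -/

/-- What is read off a sampling sketch: a sampling probability, and the vector of the frequencies
of the sampled items (all its other coordinates being `0`). -/
structure SampleReport (n : ℕ) where
  q : ℝ
  w : Fin n → ℤ

/-- The rescaled estimate `q⁻¹ ∑_{d ∈ W} g(|f_d|)`. -/
noncomputable def SampleReport.estimate {n : ℕ} (R : SampleReport n) (g : ℕ → ℝ) : ℝ :=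
  R.q⁻¹ * gsum g fun d => (R.w d).natAbs

/-- `A` samples the support of the frequency vector pairwise independently, at a rate of order
`r / |supp f|`: its coin flips determine, for every level `i ≤ ℓ`, pairwise independent
Bernoulli(`2⁻ⁱ`) variables `X i d`, `d ∈ [n]`, and, on each of the given streams, with
probability at least `7 / 9` the report consists of `q = 2⁻ⁱ` and of the exact frequencies of
the items with `X i d = 1`, for a level `i` with
`min {1, 9 r / |supp f|} ≤ q ≤ C r / |supp f|` (written without division). -/
def SamplesSupport {n : ℕ} (A : StreamAlg n (SampleReport n)) (r C : ℝ)
    (streams : Set (UpdateStream n)) : Prop :=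
  ∃ (ℓ : ℕ) (X : ℕ → Fin n → A.Coins → Bool),
    (∀ i ≤ ℓ, ∀ d, A.prob (fun ω => X i d ω = true) = (1 / 2) ^ i) ∧
    (∀ i ≤ ℓ, ∀ d d', d ≠ d' →
      A.prob (fun ω => X i d ω = true ∧ X i d' ω = true) = (1 / 2) ^ i * (1 / 2) ^ i) ∧
    ∀ S ∈ streams,
      7 / 9 ≤ A.prob fun ω => ∃ i ≤ ℓ,
        (A.result ω S).q = (1 / 2) ^ i ∧
        (∀ d, (A.result ω S).w d = if X i d ω = true then freq S d else 0) ∧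
        min ((vsupp (absFreq S)).card : ℝ) (9 * r) ≤
          (A.result ω S).q * (vsupp (absFreq S)).card ∧
        (A.result ω S).q * (vsupp (absFreq S)).card ≤ C * r

/-- `A` is a sampling sketch at rate `r` whose estimate is universal, on the given streams, for
all the decreasing functions `g` and accuracies `ε` such that `σ(ε, g, m, n) / ε ≤ r`. -/
def IsUniversalSketch {n : ℕ} (A : StreamAlg n (SampleReport n)) (m : ℕ) (r C : ℝ)
    (streams : Set (UpdateStream n)) : Prop :=
  SamplesSupport A r C streams ∧
    ∀ (g : ℕ → ℝ) (ε : ℝ), IsDecreasingFn g → 0 < ε → ε ≤ 1 → (sigma ε g m n : ℝ) / ε ≤ r →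
      IsApproxAlg (A.mapOutput fun R => R.estimate g) g ε streams

/-! The items are subsampled at nested levels, level `i` keeping each item with probability `2⁻ⁱ`,
pairwise independently. The sketch reports the exact frequencies at the least level `L` where at
most `s = ⌈400 r⌉` items of the support survive. This rule does not involve `g`, hence universality.

Let `F` be the support size and `G = g(f)`. If `F ≤ s`, then `L = 0` and the estimate is exact.
Otherwise let `i₀` be the first level with `2⁻ⁱ F ≤ s/2`; Chebyshev confines `L` to the three levels
ending at `i₀` (`exists_leastLevel_window`), so `q F` is of order `r`.

For accuracy, cut the support into about `F/(σ+1)` disjoint blocks of `σ+1` items. By maximality of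
`σ` each block has mass above `ε⁻¹ g(1)`, which gives `F ε⁻¹ g(1) ≤ 4 σ G` (`card_mul_le_gsum`). As
`g² ≤ g(1) g` on the support, the relative variance at rate `p` is at most `g(1)/(pG) ≤ 4 σ ε/(pF)`,
and Chebyshev gives failure probability of order `r/s` at a fixed level
(`uprob_estimate_restrict_le`). The level depends on the sample, so a union bound runs over the
three levels.

The levels come from a random affine map over a field with `2^k` elements, a seed of `2k` bits. On
turnstile streams, each level stores integer linear measurements: `2s` power sums leave at most one
`s`-sparse candidate, and a fingerprint at a random point rejects a wrong one
(`uprob_not_isDecodable_le`). On insertion-only streams supports only grow, so `L` only increases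
and the sample itself can be maintained without error (`foldl_insertionStep`). -/

/-! ### Self-delimiting codes -/

/-- A self-delimiting code of a natural number: every binary digit is preceded by `true`, and
`false` marks the end. -/
def natCode (x : ℕ) : List Bool :=
  x.bits.flatMap (fun b => [true, b]) ++ [false]

/-- The concatenation of the codes of a list of natural numbers. -/
def listCode (l : List ℕ) : List Bool := l.flatMap natCode

theorem length_natCode (x : ℕ) : (natCode x).length = 2 * x.size + 1 := by
  have h : ∀ l : List Bool, (l.flatMap fun b => [true, b]).length = 2 * l.length := by
    intro l
    induction l with
    | nil => rfl
    | cons b l ih => simp only [List.flatMap_cons, List.length_append, ih, List.length_cons,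
        List.length_nil]; ring
  simp [natCode, h, Nat.size_eq_bits_len]

theorem length_listCode (l : List ℕ) :
    (listCode l).length = (l.map fun x => 2 * x.size + 1).sum := by
  simp [listCode, List.length_flatMap, length_natCode]

theorem bits_injective : Function.Injective Nat.bits := fun a b h =>
  Nat.digits.injective 2 (by rw [Nat.digits_two_eq_bits, Nat.digits_two_eq_bits, h])

/-- The end mark `false` stands where another digit would be announced by `true`, so the code is
prefix-free and the rest of the string is recovered too. -/
theorem flatMap_digits_append_inj (l l' : List Bool) (u u' : List Bool)
    (h : l.flatMap (fun b => [true, b]) ++ false :: u =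
      l'.flatMap (fun b => [true, b]) ++ false :: u') : l = l' ∧ u = u' := by
  induction l generalizing l' with
  | nil =>
    cases l' with
    | nil => simpa using h
    | cons b l' => simp at h
  | cons b l ih =>
    cases l' with
    | nil => simp at h
    | cons b' l' =>
      simp only [List.flatMap_cons, List.cons_append, List.nil_append, List.cons.injEq,
        true_and] at h
      obtain ⟨h1, h2⟩ := ih l' h.2
      exact ⟨by rw [h.1, h1], h2⟩

theorem listCode_injective : Function.Injective listCode := by
  intro l
  induction l with
  | nil =>
    intro l' h
    cases l' with
    | nil => rfl
    | cons x l' => simp [listCode, natCode] at h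
  | cons x l ih =>
    intro l' h
    cases l' with
    | nil => simp [listCode, natCode] at h
    | cons y l' =>
      simp only [listCode, natCode, List.flatMap_cons, List.append_assoc, List.cons_append,
        List.nil_append] at h
      obtain ⟨h1, h2⟩ := flatMap_digits_append_inj _ _ _ _ h
      rw [bits_injective h1, ih h2]

/-! ### Algorithms given by a state space and a code of the states -/

namespace StreamAlg

/-- The algorithm that keeps a state of type `St`, stored through the code `code`. -/
noncomputable def ofState {n : ℕ} {O St : Type} [Nonempty St] (coins : ℕ)
    (init : (Fin coins → Bool) → St) (step : St → Fin n × ℤ → St) (output : St → O)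
    (code : St → List ℕ) : StreamAlg n O where
  coins := coins
  init ω := listCode (code (init ω))
  step x u := listCode (code (step (Function.invFun (listCode ∘ code) x) u))
  output x := output (Function.invFun (listCode ∘ code) x)

section

variable {n : ℕ} {O St : Type} [Nonempty St] {coins : ℕ}
  {init : (Fin coins → Bool) → St} {step : St → Fin n × ℤ → St} {output : St → O}
  {code : St → List ℕ}

theorem invFun_listCode (hc : Function.Injective code) (x : St) :
    Function.invFun (listCode ∘ code) (listCode (code x)) = x :=
  Function.leftInverse_invFun (listCode_injective.comp hc) x

/-- Decoding undoes encoding on every reachable memory, so the bit-string algorithm simulates the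
abstract one and only the states need study. -/
theorem memory_ofState (hc : Function.Injective code) (ω : Fin coins → Bool)
    (S : UpdateStream n) :
    (ofState coins init step output code).memory ω S =
      listCode (code (S.foldl step (init ω))) := by
  induction S using List.reverseRecOn with
  | nil => rfl
  | append_singleton S u ih =>
    unfold memory at ih ⊢
    rw [List.foldl_append, List.foldl_append, ih]
    simp [ofState, invFun_listCode hc]

theorem result_ofState (hc : Function.Injective code) (ω : Fin coins → Bool)
    (S : UpdateStream n) :
    (ofState coins init step output code).result ω S = output (S.foldl step (init ω)) := by
  unfold result
  rw [memory_ofState hc]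
  simp [ofState, invFun_listCode hc]

theorem storage_ofState_le (hc : Function.Injective code) (S : UpdateStream n) (B : ℕ)
    (hB : ∀ ω k, ((code ((S.take k).foldl step (init ω))).map
      fun x => 2 * x.size + 1).sum ≤ B) :
    (ofState coins init step output code).storage S ≤ B := by
  refine Finset.sup_le fun ω _ => Finset.sup_le fun k _ => ?_
  refine (congrArg List.length (memory_ofState hc ω _)).trans_le ?_
  rw [length_listCode]
  exact hB ω k

end

end StreamAlg

/-! ### Frequencies -/

section

variable {n : ℕ}

theorem freq_append_singleton (S : UpdateStream n) (u : Fin n × ℤ) (d : Fin n) :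
    freq (S ++ [u]) d = freq S d + if u.1 = d then u.2 else 0 := by
  simp [freq]

theorem absFreq_take_le_maxFreq (S : UpdateStream n) (k : ℕ) (d : Fin n) :
    absFreq (S.take k) d ≤ maxFreq S := by
  have h : ∀ k ≤ S.length, absFreq (S.take k) d ≤ maxFreq S := by
    intro k hk
    refine le_max_of_le_right ?_
    refine le_trans ?_ (Finset.le_sup (f := fun k => Finset.univ.sup fun d =>
      absFreq (S.take k) d) (Finset.mem_range.2 (Nat.lt_succ_of_le hk)))
    exact Finset.le_sup (f := fun d => absFreq (S.take k) d) (Finset.mem_univ d)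
  rcases le_total k S.length with hk | hk
  · exact h k hk
  · rw [List.take_of_length_le hk, ← List.take_length (l := S)]
    simpa using h S.length le_rfl

theorem le_maxFreq (S : UpdateStream n) : n ≤ maxFreq S := le_max_left _ _

end

/-! ### Binary lengths -/

theorem size_le_of_le_pow {x M e : ℕ} (he : e ≠ 0) (h : x ≤ M ^ e) : x.size ≤ e * M.size := by
  rw [Nat.size_le, mul_comm, pow_mul]
  exact h.trans_lt (Nat.pow_lt_pow_left M.lt_size_self he)

/-- The length is at most `1 + log x / log 2 ≤ 2 log x / log 2`, and `2 / log 2 < 3`. -/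
theorem size_le_three_mul_log {x : ℕ} (hx : 2 ≤ x) : (x.size : ℝ) ≤ 3 * Real.log x := by
  have hs : 1 ≤ x.size := Nat.size_pos.2 (by omega)
  have h1 : 2 ^ (x.size - 1) ≤ x := Nat.lt_size.1 (by omega)
  have h2 : ((2 : ℝ) ^ (x.size - 1)) ≤ x := by exact_mod_cast h1
  have h3 := Real.log_le_log (by positivity) h2
  rw [Real.log_pow, Nat.cast_sub hs] at h3
  have h4 : Real.log 2 ≤ Real.log x := Real.log_le_log (by norm_num) (by exact_mod_cast hx)
  have h5 := Real.log_two_gt_d9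
  have h6 : (1 : ℝ) ≤ x.size := by exact_mod_cast hs
  push_cast at h3
  nlinarith

/-! ### Uniform probability on a finite type -/

open Classical in
/-- The probability of an event under the uniform distribution on a finite type. -/
noncomputable def uprob {Ω : Type*} [Fintype Ω] (E : Ω → Prop) : ℝ :=
  ((Finset.univ.filter E).card : ℝ) / Fintype.card Ω

theorem StreamAlg.prob_eq_uprob {n : ℕ} {O : Type} (A : StreamAlg n O) (E : A.Coins → Prop) :
    A.prob E = uprob E := by
  simp [StreamAlg.prob, uprob]

section uprob

variable {Ω Ω' : Type*} [Fintype Ω] [Fintype Ω']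

theorem uprob_eq_card (E : Ω → Prop) [DecidablePred E] :
    uprob E = ((Finset.univ.filter E).card : ℝ) / Fintype.card Ω := by
  unfold uprob
  congr!

theorem uprob_mono {E E' : Ω → Prop} (h : ∀ ω, E ω → E' ω) : uprob E ≤ uprob E' := by
  unfold uprob
  gcongr 1
  exact_mod_cast Finset.card_le_card fun ω => by simpa using h ω

theorem uprob_or_le (E E' : Ω → Prop) : uprob (fun ω => E ω ∨ E' ω) ≤ uprob E + uprob E' := by
  classical
  rw [uprob_eq_card, uprob_eq_card, uprob_eq_card, ← add_div]
  gcongr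
  rw [Finset.filter_or]
  exact_mod_cast Finset.card_union_le _ _

theorem uprob_exists_le {ι : Type*} (s : Finset ι) (E : ι → Ω → Prop) :
    uprob (fun ω => ∃ i ∈ s, E i ω) ≤ ∑ i ∈ s, uprob (E i) := by
  classical
  induction s using Finset.induction_on with
  | empty => simp [uprob]
  | insert i s hi ih =>
    rw [Finset.sum_insert hi]
    refine le_trans (uprob_mono ?_) ((uprob_or_le (E i) fun ω => ∃ i ∈ s, E i ω).trans
      (by gcongr))
    rintro ω ⟨j, hj, h⟩
    rcases Finset.mem_insert.1 hj with rfl | hj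
    · exact Or.inl h
    · exact Or.inr ⟨j, hj, h⟩

theorem one_sub_uprob_not_le [Nonempty Ω] (E : Ω → Prop) :
    1 - uprob (fun ω => ¬ E ω) ≤ uprob E := by
  classical
  rw [uprob_eq_card, uprob_eq_card]
  have h := Finset.card_filter_add_card_filter_not (s := (Finset.univ : Finset Ω)) E
  have h0 : (0 : ℝ) < Fintype.card Ω := by exact_mod_cast Fintype.card_pos
  rw [sub_le_iff_le_add, ← add_div, le_div_iff₀ h0, one_mul]
  rw [Finset.card_univ] at h
  have h' : ((Fintype.card Ω : ℕ) : ℝ) = ((Finset.univ.filter E).card : ℝ) +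
      ((Finset.univ.filter fun ω => ¬ E ω).card : ℝ) := by exact_mod_cast h.symm
  exact h'.le

theorem uprob_comp_equiv (e : Ω ≃ Ω') (E : Ω' → Prop) : uprob (fun ω => E (e ω)) = uprob E := by
  classical
  unfold uprob
  rw [Fintype.card_congr e]
  congr 2
  refine Finset.card_bij' (fun ω _ => e ω) (fun ω _ => e.symm ω) ?_ ?_ ?_ ?_ <;> simp

/-- Conditioning on the first coordinate; later, the sampling seed is fixed and only the fingerprint
point is random. -/
theorem uprob_le_of_forall_fst {δ : ℝ} (hδ : 0 ≤ δ) (E : Ω × Ω' → Prop)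
    (h : ∀ a, uprob (fun b => E (a, b)) ≤ δ) : uprob E ≤ δ := by
  classical
  have hE : ((Finset.univ.filter E).card : ℝ) =
      ∑ a : Ω, ((Finset.univ.filter fun b => E (a, b)).card : ℝ) := by
    simp only [Finset.card_filter, Nat.cast_sum]
    rw [Fintype.sum_prod_type]
  rcases isEmpty_or_nonempty Ω' with _ | _
  · simpa [uprob] using hδ
  have h0 : (0 : ℝ) < Fintype.card Ω' := by exact_mod_cast Fintype.card_pos
  unfold uprob at h ⊢
  refine div_le_of_le_mul₀ (by positivity) hδ ?_
  rw [hE, Fintype.card_prod]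
  refine (Finset.sum_le_sum fun a _ => (div_le_iff₀ h0).1 (h a)).trans ?_
  simp [Finset.card_univ]
  exact le_of_eq (by ring)

theorem uprob_comp_fst [Nonempty Ω'] (E : Ω → Prop) :
    uprob (fun ω : Ω × Ω' => E ω.1) = uprob E := by
  classical
  have h0 : (Fintype.card Ω' : ℝ) ≠ 0 := by exact_mod_cast Fintype.card_ne_zero
  unfold uprob
  have : (Finset.univ.filter fun ω : Ω × Ω' => E ω.1) =
      (Finset.univ.filter E) ×ˢ (Finset.univ : Finset Ω') := by
    ext; simp
  rw [this, Finset.card_product, Fintype.card_prod, Finset.card_univ]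
  push_cast
  rw [mul_div_mul_right _ _ h0]

theorem uprob_eq_sum (E : Ω → Prop) [DecidablePred E] :
    uprob E = (∑ ω, if E ω then (1 : ℝ) else 0) / Fintype.card Ω := by
  unfold uprob
  rw [Finset.sum_boole]
  congr!

/-- Chebyshev's inequality for weighted sums of pairwise independent Bernoulli variables. -/
theorem chebyshev_pairwise [Nonempty Ω] {ι : Type*} [Fintype ι] (X : ι → Ω → Bool) (a : ι → ℝ)
    {p t : ℝ} (ht : 0 < t)
    (h1 : ∀ d, uprob (fun ω => X d ω = true) = p)
    (h2 : ∀ d d', d ≠ d' → uprob (fun ω => X d ω = true ∧ X d' ω = true) = p * p) :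
    uprob (fun ω => t ≤ |∑ d, a d * (if X d ω = true then 1 else 0) - p * ∑ d, a d|) ≤
      p * (∑ d, a d ^ 2) / t ^ 2 := by
  classical
  set N : ℝ := (Fintype.card Ω : ℝ) with hN
  have hN0 : 0 < N := by rw [hN]; exact_mod_cast Fintype.card_pos
  set I : ι → Ω → ℝ := fun d ω => if X d ω = true then 1 else 0 with hI
  have s1 : ∀ d, ∑ ω, I d ω = p * N := fun d => by
    rw [← h1 d, uprob_eq_sum, div_mul_cancel₀ _ hN0.ne']
  have s2 : ∀ d d', d ≠ d' → ∑ ω, I d ω * I d' ω = p * p * N := fun d d' hd => by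
    rw [← h2 d d' hd, uprob_eq_sum, div_mul_cancel₀ _ hN0.ne']
    refine Finset.sum_congr rfl fun ω _ => ?_
    simp only [hI]
    cases X d ω <;> cases X d' ω <;> simp
  have s3 : ∀ d, ∑ ω, I d ω * I d ω = p * N := fun d => by
    rw [← s1 d]
    refine Finset.sum_congr rfl fun ω _ => ?_
    simp only [hI]
    split_ifs <;> simp
  -- Pairwise independence removes the off-diagonal covariances, so the variance of the sum is
  -- diagonal.
  have cov : ∀ d d', ∑ ω, (I d ω - p) * (I d' ω - p) = if d = d' then (p - p * p) * N else 0 := by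
    intro d d'
    have : ∑ ω, (I d ω - p) * (I d' ω - p) =
        ∑ ω, I d ω * I d' ω - p * ∑ ω, I d ω - p * ∑ ω, I d' ω + p * p * N := by
      rw [Finset.mul_sum, Finset.mul_sum, ← Finset.sum_sub_distrib, ← Finset.sum_sub_distrib]
      have : p * p * N = ∑ _ω : Ω, p * p := by simp [hN]; ring
      rw [this, ← Finset.sum_add_distrib]
      exact Finset.sum_congr rfl fun ω _ => by ring
    rw [this, s1, s1]
    split_ifs with h
    · subst h; rw [s3]; ring
    · rw [s2 _ _ h]; ring
  have var : ∑ ω, (∑ d, a d * I d ω - p * ∑ d, a d) ^ 2 = (p - p * p) * N * ∑ d, a d ^ 2 := by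
    have e1 : ∀ ω, (∑ d, a d * I d ω - p * ∑ d, a d) ^ 2 =
        ∑ d, ∑ d', a d * a d' * ((I d ω - p) * (I d' ω - p)) := by
      intro ω
      rw [Finset.mul_sum, ← Finset.sum_sub_distrib, sq, Finset.sum_mul_sum]
      exact Finset.sum_congr rfl fun d _ => Finset.sum_congr rfl fun d' _ => by ring
    rw [Finset.sum_congr rfl fun ω _ => e1 ω, Finset.sum_comm]
    rw [Finset.mul_sum]
    refine Finset.sum_congr rfl fun d _ => ?_
    rw [Finset.sum_comm]
    simp_rw [← Finset.mul_sum, cov]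
    simp
    ring
  -- Markov's inequality for the squared deviation.
  have mark : t ^ 2 * ∑ ω, (if t ≤ |∑ d, a d * I d ω - p * ∑ d, a d| then (1 : ℝ) else 0) ≤
      ∑ ω, (∑ d, a d * I d ω - p * ∑ d, a d) ^ 2 := by
    rw [Finset.mul_sum]
    refine Finset.sum_le_sum fun ω _ => ?_
    split_ifs with h
    · rw [mul_one, ← sq_abs (∑ d, a d * I d ω - p * ∑ d, a d)]
      gcongr
    · simp; positivity
  rw [uprob_eq_sum, div_le_div_iff₀ hN0 (by positivity)]
  rw [var] at mark
  have hs : 0 ≤ ∑ d, a d ^ 2 := Finset.sum_nonneg fun _ _ => sq_nonneg _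
  have hp : (p - p * p) * N * ∑ d, a d ^ 2 ≤ p * N * ∑ d, a d ^ 2 := by
    gcongr
    nlinarith [mul_self_nonneg p]
  have := mark.trans hp
  change (∑ ω, (if t ≤ |∑ d, a d * I d ω - p * ∑ d, a d| then (1 : ℝ) else 0)) * t ^ 2 ≤ _
  nlinarith [this]

end uprob

/-! ### Nested sampling levels -/

section restriction

variable {Ω : Type*} {n : ℕ} {X : ℕ → Fin n → Ω → Bool}

/-- The vector of absolute values. -/
def absVec (f : Fin n → ℤ) (d : Fin n) : ℕ := (f d).natAbs

/-- The size of the support of an integer vector. -/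
def nnz (f : Fin n → ℤ) : ℕ := (vsupp (absVec f)).card

/-- The restriction of a vector to the items sampled at level `i`. -/
def restrict (X : ℕ → Fin n → Ω → Bool) (i : ℕ) (ω : Ω) (f : Fin n → ℤ) (d : Fin n) : ℤ :=
  if X i d ω = true then f d else 0

/-- The least level at which at most `s` items of the support are sampled. -/
noncomputable def leastLevel (X : ℕ → Fin n → Ω → Bool) (s : ℕ) (ω : Ω) (f : Fin n → ℤ) : ℕ :=
  sInf {i | nnz (restrict X i ω f) ≤ s}

theorem nnz_eq_card (f : Fin n → ℤ) : nnz f = (Finset.univ.filter fun d => f d ≠ 0).card := by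
  simp [nnz, vsupp, absVec]

theorem nnz_mono {f f' : Fin n → ℤ} (h : ∀ d, f d ≠ 0 → f' d ≠ 0) : nnz f ≤ nnz f' := by
  rw [nnz_eq_card, nnz_eq_card]
  exact Finset.card_le_card fun d => by simpa using h d

theorem nnz_le (f : Fin n → ℤ) : nnz f ≤ n := by
  rw [nnz_eq_card]
  exact (Finset.card_le_univ _).trans (by simp)

theorem leastLevel_le {s : ℕ} {ω : Ω} {f : Fin n → ℤ} {i : ℕ}
    (h : nnz (restrict X i ω f) ≤ s) : leastLevel X s ω f ≤ i :=
  Nat.sInf_le h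

theorem gsum_eq_sum (g : ℕ → ℝ) (v : Fin n → ℕ) :
    gsum g v = ∑ d, if v d ≠ 0 then g (v d) else 0 := by
  simp only [gsum, vsupp, Finset.sum_filter]

theorem gsum_one (f : Fin n → ℤ) : gsum (fun _ => 1) (absVec f) = nnz f := by
  simp [gsum, nnz]

theorem gsum_restrict (g : ℕ → ℝ) (i : ℕ) (ω : Ω) (f : Fin n → ℤ) :
    gsum g (absVec (restrict X i ω f)) =
      ∑ d, (if absVec f d ≠ 0 then g (absVec f d) else 0) *
        (if X i d ω = true then 1 else 0) := by
  rw [gsum_eq_sum]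
  refine Finset.sum_congr rfl fun d _ => ?_
  unfold absVec restrict
  split_ifs <;> simp_all

end restriction

/-- Nested pairwise independent sampling: the variables `X i d`, for a fixed `i ≤ ℓ`, are pairwise
independent Bernoulli(`2⁻ⁱ`) variables, nothing is sampled beyond the level `ℓ`, and what is
sampled at some level is also sampled at all lower levels. -/
structure IsLevelFamily {Ω : Type*} [Fintype Ω] {n : ℕ} (ℓ : ℕ) (X : ℕ → Fin n → Ω → Bool) :
    Prop where
  prob_one : ∀ i ≤ ℓ, ∀ d, uprob (fun ω => X i d ω = true) = (1 / 2) ^ i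
  prob_pair : ∀ i ≤ ℓ, ∀ d d', d ≠ d' →
    uprob (fun ω => X i d ω = true ∧ X i d' ω = true) = (1 / 2) ^ i * (1 / 2) ^ i
  anti : ∀ i j d ω, i ≤ j → X j d ω = true → X i d ω = true
  zero : ∀ d ω, X 0 d ω = true
  top : ∀ i d ω, ℓ < i → X i d ω = false

section sampling

variable {Ω : Type*} [Fintype Ω] {n ℓ : ℕ} {X : ℕ → Fin n → Ω → Bool}

theorem nnz_restrict_anti (hX : IsLevelFamily ℓ X) {i j : ℕ} (hij : i ≤ j) (ω : Ω)
    (f : Fin n → ℤ) : nnz (restrict X j ω f) ≤ nnz (restrict X i ω f) := by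
  refine nnz_mono fun d => ?_
  unfold restrict
  split_ifs with h1 h2
  · exact id
  · exact absurd (hX.anti _ _ _ _ hij h1) h2
  · simp
  · simp

theorem nnz_restrict_le_of_lt (hX : IsLevelFamily ℓ X) (ω : Ω) (f : Fin n → ℤ) (s : ℕ) {i : ℕ}
    (hi : ℓ < i) : nnz (restrict X i ω f) ≤ s := by
  have : nnz (restrict X i ω f) = 0 := by
    rw [nnz_eq_card]
    simp [restrict, hX.top _ _ _ hi]
  omega

/-- Level `ℓ + 1` samples nothing, so the infimum is over a nonempty set and is attained. -/
theorem nnz_restrict_leastLevel_le (hX : IsLevelFamily ℓ X) (s : ℕ) (ω : Ω) (f : Fin n → ℤ) :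
    nnz (restrict X (leastLevel X s ω f) ω f) ≤ s :=
  Nat.sInf_mem (s := {i | nnz (restrict X i ω f) ≤ s})
    ⟨ℓ + 1, nnz_restrict_le_of_lt hX ω f s (Nat.lt_succ_self ℓ)⟩

/-- The deviation of a sampled sum from its expectation. -/
theorem uprob_gsum_restrict_le [Nonempty Ω] (hX : IsLevelFamily ℓ X) (g : ℕ → ℝ)
    (f : Fin n → ℤ) {i : ℕ} (hi : i ≤ ℓ) {t : ℝ} (ht : 0 < t) :
    uprob (fun ω => t ≤ |gsum g (absVec (restrict X i ω f)) -
      (1 / 2) ^ i * gsum g (absVec f)|) ≤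
      (1 / 2) ^ i * gsum (fun x => g x ^ 2) (absVec f) / t ^ 2 := by
  have h := chebyshev_pairwise (X i)
    (fun d => if absVec f d ≠ 0 then g (absVec f d) else 0) ht (hX.prob_one i hi)
    (hX.prob_pair i hi)
  rw [gsum_eq_sum g (absVec f), gsum_eq_sum (fun x => g x ^ 2) (absVec f)]
  simp only [gsum_restrict]
  refine h.trans (le_of_eq ?_)
  congr 2
  refine Finset.sum_congr rfl fun d _ => ?_
  split_ifs <;> simp

theorem uprob_nnz_restrict_le [Nonempty Ω] (hX : IsLevelFamily ℓ X)
    (f : Fin n → ℤ) {i : ℕ} (hi : i ≤ ℓ) {t : ℝ} (ht : 0 < t) :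
    uprob (fun ω => t ≤ |(nnz (restrict X i ω f) : ℝ) - (1 / 2) ^ i * nnz f|) ≤
      (1 / 2) ^ i * nnz f / t ^ 2 := by
  have h := uprob_gsum_restrict_le hX (fun _ => 1) f hi ht
  simp only [gsum_one, one_pow] at h
  exact h

/-- With high probability, the least level is one of three levels with a sampling rate of
order `s / |supp f|`. -/
theorem exists_leastLevel_window [Nonempty Ω] (hX : IsLevelFamily ℓ X) (hn : n < 2 ^ ℓ) {s : ℕ}
    (hs : 2 ≤ s) (f : Fin n → ℤ) (hf : s < nnz f) :
    ∃ i₀ ≤ ℓ, (s : ℝ) / 4 < (1 / 2) ^ i₀ * nnz f ∧ (1 / 2) ^ i₀ * (nnz f : ℝ) ≤ s / 2 ∧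
      uprob (fun ω => ¬ (leastLevel X s ω f ≤ i₀ ∧ i₀ ≤ leastLevel X s ω f + 2)) ≤ 4 / s := by
  classical
  have hs' : (2 : ℝ) ≤ s := by exact_mod_cast hs
  have hf' : (s : ℝ) < nnz f := by exact_mod_cast hf
  have hex : ∃ i, (1 / 2 : ℝ) ^ i * (nnz f : ℝ) ≤ s / 2 := by
    refine ⟨ℓ, ?_⟩
    have h1 : (nnz f : ℝ) ≤ 2 ^ ℓ := by exact_mod_cast (nnz_le f).trans hn.le
    have h2 : (1 / 2 : ℝ) ^ ℓ * (nnz f : ℝ) ≤ (1 / 2) ^ ℓ * 2 ^ ℓ := by gcongr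
    rw [← mul_pow] at h2
    norm_num at h2
    norm_num
    linarith
  set i₀ := Nat.find hex with hi₀
  have hmax := Nat.find_spec hex
  rw [← hi₀] at hmax
  have hℓ : i₀ ≤ ℓ := by
    refine Nat.find_min' hex ?_
    have h1 : (nnz f : ℝ) ≤ 2 ^ ℓ := by exact_mod_cast (nnz_le f).trans hn.le
    have h2 : (1 / 2 : ℝ) ^ ℓ * (nnz f : ℝ) ≤ (1 / 2) ^ ℓ * 2 ^ ℓ := by gcongr
    rw [← mul_pow] at h2
    norm_num at h2
    norm_num
    linarith
  have hpos : i₀ ≠ 0 := by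
    intro h
    rw [h] at hmax
    norm_num at hmax
    linarith
  obtain ⟨k, hk⟩ := Nat.exists_eq_succ_of_ne_zero hpos
  -- Minimality of `i₀`: the level before still expects more than `s/2` items, so `i₀` itself
  -- expects more than `s/4`.
  have hmin : (s : ℝ) / 2 < (1 / 2) ^ k * nnz f :=
    not_le.1 (Nat.find_min hex (show k < Nat.find hex by omega))
  have hlow : (s : ℝ) / 4 < (1 / 2) ^ i₀ * nnz f := by
    rw [hk, pow_succ]
    linarith
  refine ⟨i₀, hℓ, hlow, hmax, ?_⟩
  -- The mean is at most `s/2`, so exceeding `s` is a deviation of `s/2`.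
  have h1 : uprob (fun ω => s < nnz (restrict X i₀ ω f)) ≤ 2 / s := by
    refine (uprob_mono fun ω hω => ?_).trans
      ((uprob_nnz_restrict_le hX f hℓ (t := s / 2) (by linarith)).trans ?_)
    · have : (s : ℝ) < nnz (restrict X i₀ ω f) := by exact_mod_cast hω
      refine le_trans ?_ (le_abs_self _)
      linarith
    · rw [div_le_div_iff₀ (by positivity) (by positivity)]
      nlinarith
  -- Three levels lower the mean `μ` exceeds `2s`, so at most `s` survivors is a deviation of `μ/2`.
  -- The guard `3 ≤ i₀` keeps the subtraction from truncating.
  have h2 : uprob (fun ω => 3 ≤ i₀ ∧ nnz (restrict X (i₀ - 3) ω f) ≤ s) ≤ 2 / s := by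
    by_cases h3 : 3 ≤ i₀
    · set j := i₀ - 3 with hj
      have hj' : i₀ = j + 3 := by omega
      set μ : ℝ := (1 / 2) ^ j * nnz f with hμ
      have hμ2 : 2 * (s : ℝ) < μ := by
        rw [hj', pow_add] at hlow
        rw [hμ]
        linarith
      refine (uprob_mono fun ω hω => ?_).trans
        ((uprob_nnz_restrict_le hX f (i := j) (by omega) (t := μ / 2) (by linarith)).trans ?_)
      · have : (nnz (restrict X j ω f) : ℝ) ≤ s := by exact_mod_cast hω.2
        refine le_trans ?_ (neg_le_abs _)
        rw [← hμ]
        linarith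
      · rw [← hμ, div_le_div_iff₀ (by nlinarith) (by positivity)]
        nlinarith
    · simp only [h3, false_and, uprob, Finset.filter_false, Finset.card_empty, Nat.cast_zero,
        zero_div]
      positivity
  refine (uprob_mono fun ω hω => ?_).trans ((uprob_or_le _ _).trans
    ((add_le_add h1 h2).trans (le_of_eq (by ring))))
  by_contra hcon
  rw [not_or] at hcon
  refine hω ⟨leastLevel_le (not_lt.1 hcon.1), ?_⟩
  by_contra hlt
  refine hcon.2 ⟨by omega, ?_⟩
  exact (nnz_restrict_anti hX (by omega) ω f).trans (nnz_restrict_leastLevel_le hX s ω f)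

end sampling

/-! ### The parameter `sigma` and streaming sums -/

section sigma

variable {n m : ℕ} {ε : ℝ} {g : ℕ → ℝ}

theorem bddAbove_sigma_set (ε : ℝ) (g : ℕ → ℝ) (m n : ℕ) :
    BddAbove {k | ∃ f ∈ freqVectors n m, gsum g f ≤ ε⁻¹ * g 1 ∧ (vsupp f).card = k} := by
  refine ⟨n, ?_⟩
  rintro k ⟨f, -, -, rfl⟩
  exact (Finset.card_le_univ _).trans (by simp)

/-- A unit vector has `g(f) = g(1) ≤ ε⁻¹ g(1)`. This makes the rate `σ/ε` at least `1`. -/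
theorem one_le_sigma (hg : IsDecreasingFn g) (hε : 0 < ε) (hε1 : ε ≤ 1) (hn : 1 ≤ n)
    (hm : 1 ≤ m) : 1 ≤ sigma ε g m n := by
  have hs : vsupp (Pi.single (⟨0, hn⟩ : Fin n) 1 : Fin n → ℕ) = {⟨0, hn⟩} := by
    ext d
    simp [vsupp, Pi.single_apply]
  refine le_csSup (bddAbove_sigma_set ε g m n) ⟨Pi.single ⟨0, hn⟩ 1, ?_, ?_, by simp [hs]⟩
  · simpa [freqVectors] using hm
  · have h1 : 1 ≤ ε⁻¹ := (one_le_inv₀ hε).2 hε1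
    simp only [gsum, hs, Finset.sum_singleton, Pi.single_eq_same]
    nlinarith [hg.1 1 le_rfl]

/-- Any set of more than `σ` items of the support carries more than `ε⁻¹ g(1)`. -/
theorem lt_sum_of_sigma_lt_card {f : Fin n → ℕ} (hf : f ∈ freqVectors n m) {T : Finset (Fin n)}
    (hT : T ⊆ vsupp f) (hc : sigma ε g m n < T.card) : ε⁻¹ * g 1 < ∑ d ∈ T, g (f d) := by
  classical
  by_contra! hle
  -- Otherwise the restriction of `f` to `T` would compete in the maximum defining `σ`.
  set f' : Fin n → ℕ := fun d => if d ∈ T then f d else 0 with hf'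
  have hs : vsupp f' = T := by
    ext d
    simp only [vsupp, hf', Finset.mem_filter, Finset.mem_univ, true_and]
    constructor
    · intro h
      by_contra hd
      simp [hd] at h
    · intro h
      have := hT h
      simp only [vsupp, Finset.mem_filter, Finset.mem_univ, true_and] at this
      simpa [h] using this
  refine hc.not_ge (le_csSup (bddAbove_sigma_set ε g m n) ⟨f', ?_, ?_, by rw [hs]⟩)
  · refine (Finset.sum_le_sum fun d _ => ?_).trans (show ∑ d, f d ≤ m from hf)
    simp only [hf']
    split_ifs <;> simp
  · refine le_trans (le_of_eq ?_) hle
    rw [gsum, hs]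
    exact Finset.sum_congr rfl fun d hd => by simp [hf', hd]

/-- Peel off `j` disjoint blocks of `σ + 1` items, each of mass above `ε⁻¹ g(1)`. -/
theorem mul_le_sum_of_mul_le_card {f : Fin n → ℕ} (hg : IsDecreasingFn g)
    (hf : f ∈ freqVectors n m) (j : ℕ) {T : Finset (Fin n)} (hT : T ⊆ vsupp f)
    (hc : j * (sigma ε g m n + 1) ≤ T.card) : j * (ε⁻¹ * g 1) ≤ ∑ d ∈ T, g (f d) := by
  classical
  induction j generalizing T with
  | zero =>
    simp only [Nat.cast_zero, zero_mul]
    refine Finset.sum_nonneg fun d hd => hg.1 _ ?_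
    have := hT hd
    simp only [vsupp, Finset.mem_filter, Finset.mem_univ, true_and] at this
    omega
  | succ j ih =>
    rw [Nat.succ_mul] at hc
    obtain ⟨U, hU, hUc⟩ := Finset.exists_subset_card_eq (s := T) (n := sigma ε g m n + 1)
      (by omega)
    have h1 := lt_sum_of_sigma_lt_card hf (hU.trans hT) (ε := ε) (g := g) (by omega)
    have h2 := ih (T := T \ U) (Finset.sdiff_subset.trans hT) (by
      rw [Finset.card_sdiff_of_subset hU]; omega)
    rw [← Finset.sum_sdiff hU]
    push_cast
    linarith

/-- This is where `σ` controls the variance: a large support forces `g(f)` to be large compared with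
`g(1)`. -/
theorem card_mul_le_gsum {f : Fin n → ℕ} (hg : IsDecreasingFn g) (hε : 0 < ε)
    (hf : f ∈ freqVectors n m) (hσ : 1 ≤ sigma ε g m n)
    (hc : 4 * sigma ε g m n ≤ (vsupp f).card) :
    ((vsupp f).card : ℝ) * (ε⁻¹ * g 1) ≤ 4 * sigma ε g m n * gsum g f := by
  set σ := sigma ε g m n with hσ'
  set F := (vsupp f).card with hF
  have h := mul_le_sum_of_mul_le_card hg hf (F / (σ + 1)) (T := vsupp f) (ε := ε)
    subset_rfl (by rw [← hσ', ← hF]; exact Nat.div_mul_le_self _ _)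
  -- With `j` blocks, `F < (j + 1)(σ + 1)`; then `σ + 1 ≤ 2σ` and `j + 1 ≤ 2j` give the factor `4`.
  have hj : F ≤ 4 * σ * (F / (σ + 1)) := by
    have h1 := Nat.lt_div_mul_add (a := F) (b := σ + 1) (by omega)
    set j := F / (σ + 1)
    nlinarith
  have hj' : (F : ℝ) ≤ 4 * σ * ((F / (σ + 1) : ℕ) : ℝ) := by exact_mod_cast hj
  have h0 : 0 ≤ ε⁻¹ * g 1 := mul_nonneg (inv_nonneg.2 hε.le) (hg.1 1 le_rfl)
  calc (F : ℝ) * (ε⁻¹ * g 1) ≤ 4 * σ * ((F / (σ + 1) : ℕ) : ℝ) * (ε⁻¹ * g 1) := by gcongr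
    _ = 4 * σ * (((F / (σ + 1) : ℕ) : ℝ) * (ε⁻¹ * g 1)) := by ring
    _ ≤ 4 * σ * gsum g f := by gcongr; exact h

theorem gsum_sq_le (hg : IsDecreasingFn g) (f : Fin n → ℕ) :
    gsum (fun x => g x ^ 2) f ≤ g 1 * gsum g f := by
  unfold gsum
  rw [Finset.mul_sum]
  refine Finset.sum_le_sum fun d hd => ?_
  simp only [vsupp, Finset.mem_filter, Finset.mem_univ, true_and] at hd
  have h1 : 1 ≤ f d := by omega
  have := hg.1 _ h1
  have := hg.2 1 (f d) le_rfl h1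
  nlinarith

theorem gsum_nonneg (hg : IsDecreasingFn g) (f : Fin n → ℕ) : 0 ≤ gsum g f := by
  refine Finset.sum_nonneg fun d hd => hg.1 _ ?_
  simp only [vsupp, Finset.mem_filter, Finset.mem_univ, true_and] at hd
  omega

end sigma

/-! ### Accuracy of the estimate at a fixed level -/

section accuracy

variable {Ω : Type*} [Fintype Ω] {n m ℓ : ℕ} {X : ℕ → Fin n → Ω → Bool}

/-- Chebyshev with deviation `ε p G`: the bound `g(1)/(ε² p G)` becomes `4σ/(ε p F)` by
`card_mul_le_gsum`. -/
theorem uprob_estimate_restrict_le [Nonempty Ω] (hX : IsLevelFamily ℓ X) {g : ℕ → ℝ} {ε r : ℝ}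
    (hg : IsDecreasingFn g) (hε : 0 < ε) (hσ : 1 ≤ sigma ε g m n)
    (hr : (sigma ε g m n : ℝ) ≤ r * ε) (f : Fin n → ℤ) (hf : absVec f ∈ freqVectors n m)
    (hF : 4 * sigma ε g m n ≤ nnz f) {i : ℕ} (hi : i ≤ ℓ) {u : ℝ} (hu : 0 < u)
    (hiF : u ≤ (1 / 2) ^ i * nnz f) :
    uprob (fun ω => ¬ ((1 - ε) * gsum g (absVec f) ≤
        ((1 / 2) ^ i)⁻¹ * gsum g (absVec (restrict X i ω f)) ∧
      ((1 / 2) ^ i)⁻¹ * gsum g (absVec (restrict X i ω f)) ≤ (1 + ε) * gsum g (absVec f))) ≤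
      4 * r / u := by
  set p : ℝ := (1 / 2) ^ i with hp
  set G := gsum g (absVec f) with hG
  have hp0 : 0 < p := by positivity
  have hG0 : 0 ≤ G := gsum_nonneg hg _
  have hb := card_mul_le_gsum hg hε hf hσ hF
  change (nnz f : ℝ) * _ ≤ _ at hb
  rw [← hG] at hb
  have hg0 := hg.1 1 le_rfl
  have hr0 : 0 ≤ r := by
    by_contra! h
    have : (1 : ℝ) ≤ sigma ε g m n := by exact_mod_cast hσ
    nlinarith
  -- If `G = 0` the deviation `ε p G` is zero and Chebyshev is void, but all sampled sums vanish
  -- too.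
  rcases hG0.eq_or_lt with h0 | hGpos
  · have hz : ∀ ω, gsum g (absVec (restrict X i ω f)) = 0 := by
      intro ω
      refine le_antisymm ?_ (gsum_nonneg hg _)
      rw [h0, hG, gsum_restrict, gsum_eq_sum]
      refine Finset.sum_le_sum fun d _ => ?_
      split_ifs with h1 h2
      · simp
      · simpa using hg.1 _ (by omega)
      · simp
      · simp
    simp only [hz, ← h0]
    simp only [mul_zero, le_refl, and_self, not_true_eq_false, uprob, Finset.filter_false,
      Finset.card_empty, Nat.cast_zero, zero_div]
    positivity
  refine (uprob_mono fun ω hω => ?_).trans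
    ((uprob_gsum_restrict_le hX g f hi (t := ε * p * G) (by positivity)).trans ?_)
  · by_contra hcon
    rw [not_le, abs_lt] at hcon
    refine hω ⟨?_, ?_⟩
    · rw [inv_mul_eq_div, le_div_iff₀ hp0]
      linarith [hcon.1]
    · rw [inv_mul_eq_div, div_le_iff₀ hp0]
      linarith [hcon.2]
  · rw [← hp]
    have h1 : p * gsum (fun x => g x ^ 2) (absVec f) / (ε * p * G) ^ 2 ≤
        p * (g 1 * G) / (ε * p * G) ^ 2 := by
      gcongr
      exact gsum_sq_le hg _
    refine h1.trans ?_
    rw [div_le_div_iff₀ (by positivity) hu]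
    have h2 : u * g 1 ≤ 4 * r * ε ^ 2 * p * G := by
      calc u * g 1 ≤ p * nnz f * g 1 := by gcongr
        _ = p * ε * ((nnz f : ℝ) * (ε⁻¹ * g 1)) := by field_simp
        _ ≤ p * ε * (4 * sigma ε g m n * G) := by gcongr
        _ ≤ p * ε * (4 * (r * ε) * G) := by gcongr
        _ = 4 * r * ε ^ 2 * p * G := by ring
    calc p * (g 1 * G) * u = p * G * (u * g 1) := by ring
      _ ≤ p * G * (4 * r * ε ^ 2 * p * G) := by gcongr
      _ = 4 * r * (ε * p * G) ^ 2 := by ring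

end accuracy

/-! ### Sketches that report the sample at the least level -/

section universal

variable {n m ℓ : ℕ} {A : StreamAlg n (SampleReport n)} {X : ℕ → Fin n → A.Coins → Bool}

/-- The report of the sample at the least level with at most `s` sampled items. -/
noncomputable def leastReport {Ω : Type*} (X : ℕ → Fin n → Ω → Bool) (s : ℕ) (ω : Ω)
    (f : Fin n → ℤ) : SampleReport n :=
  ⟨(1 / 2) ^ leastLevel X s ω f, restrict X (leastLevel X s ω f) ω f⟩

theorem leastLevel_eq_zero (hX : IsLevelFamily ℓ X) {s : ℕ} {ω : A.Coins} {f : Fin n → ℤ}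
    (h : nnz f ≤ s) : leastLevel X s ω f = 0 := by
  refine Nat.le_zero.1 (leastLevel_le ?_)
  refine le_trans (nnz_mono fun d hd => ?_) h
  simpa [restrict, hX.zero] using hd

theorem samplesSupport_of_leastReport (hX : IsLevelFamily ℓ X) (hn : n < 2 ^ ℓ) {r C : ℝ} {s : ℕ}
    (hr : 1 ≤ r) (hs : 400 * r ≤ s) (hC : 2 * s ≤ C * r) (streams : Set (UpdateStream n))
    (hA : ∀ S ∈ streams, uprob (fun ω => ¬ (leastLevel X s ω (freq S) ≤ ℓ →
      A.result ω S = leastReport X s ω (freq S))) ≤ 1 / 100) :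
    SamplesSupport A r C streams := by
  refine ⟨ℓ, X, fun i hi d => ?_, fun i hi d d' hd => ?_, fun S hS => ?_⟩
  · rw [StreamAlg.prob_eq_uprob, hX.prob_one i hi]
  · rw [StreamAlg.prob_eq_uprob, hX.prob_pair i hi d d' hd]
  rw [StreamAlg.prob_eq_uprob]
  refine le_trans ?_ (one_sub_uprob_not_le _)
  have hs2 : 2 ≤ s := by
    have : (2 : ℝ) ≤ s := by linarith
    exact_mod_cast this
  have hs400 : (400 : ℝ) ≤ s := by linarith
  have hreport : ∀ (ω : A.Coins) (i : ℕ), i ≤ ℓ → leastLevel X s ω (freq S) = i →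
      (leastLevel X s ω (freq S) ≤ ℓ → A.result ω S = leastReport X s ω (freq S)) →
      min ((nnz (freq S) : ℝ)) (9 * r) ≤ (1 / 2) ^ i * nnz (freq S) →
      (1 / 2) ^ i * nnz (freq S) ≤ C * r →
      ∃ i ≤ ℓ, (A.result ω S).q = (1 / 2) ^ i ∧
        (∀ d, (A.result ω S).w d = if X i d ω = true then freq S d else 0) ∧
        min ((vsupp (absFreq S)).card : ℝ) (9 * r) ≤
          (A.result ω S).q * (vsupp (absFreq S)).card ∧
        (A.result ω S).q * (vsupp (absFreq S)).card ≤ C * r := by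
    intro ω i hi hL hres h1 h2
    rw [hL] at hres
    have hrep : leastReport X s ω (freq S) = ⟨(1 / 2) ^ i, restrict X i ω (freq S)⟩ := by
      rw [leastReport, hL]
    refine ⟨i, hi, ?_⟩
    rw [hres hi, hrep]
    exact ⟨rfl, fun d => rfl, h1, h2⟩
  rcases le_or_gt (nnz (freq S)) s with hF | hF
  · have hF' : (nnz (freq S) : ℝ) ≤ s := by exact_mod_cast hF
    have : uprob (fun ω => ¬ ∃ i ≤ ℓ, (A.result ω S).q = (1 / 2) ^ i ∧
        (∀ d, (A.result ω S).w d = if X i d ω = true then freq S d else 0) ∧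
        min ((vsupp (absFreq S)).card : ℝ) (9 * r) ≤
          (A.result ω S).q * (vsupp (absFreq S)).card ∧
        (A.result ω S).q * (vsupp (absFreq S)).card ≤ C * r) ≤ 1 / 100 := by
      refine (uprob_mono fun ω hω hres => hω ?_).trans (hA S hS)
      refine hreport ω 0 (Nat.zero_le _) (leastLevel_eq_zero hX hF) hres ?_ ?_
      · simp
      · simp only [pow_zero, one_mul]
        linarith
    linarith
  · obtain ⟨i₀, hi₀, hlow, hmax, hw⟩ := exists_leastLevel_window hX hn hs2 (freq S) hF
    have : uprob (fun ω => ¬ ∃ i ≤ ℓ, (A.result ω S).q = (1 / 2) ^ i ∧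
        (∀ d, (A.result ω S).w d = if X i d ω = true then freq S d else 0) ∧
        min ((vsupp (absFreq S)).card : ℝ) (9 * r) ≤
          (A.result ω S).q * (vsupp (absFreq S)).card ∧
        (A.result ω S).q * (vsupp (absFreq S)).card ≤ C * r) ≤ 1 / 100 + 4 / s := by
      refine (uprob_mono fun ω hω => ?_).trans ((uprob_or_le _ _).trans
        (add_le_add (hA S hS) hw))
      by_contra hcon
      rw [not_or, not_not, not_not] at hcon
      obtain ⟨hres, hL1, hL2⟩ := hcon
      have hpow : ((1 : ℝ) / 2) ^ i₀ ≤ (1 / 2) ^ leastLevel X s ω (freq S) :=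
        pow_le_pow_of_le_one (by norm_num) (by norm_num) hL1
      have hpow2 : ((1 : ℝ) / 2) ^ leastLevel X s ω (freq S) ≤ 4 * (1 / 2) ^ i₀ := by
        have := pow_le_pow_of_le_one (a := (1 : ℝ) / 2) (by norm_num) (by norm_num) hL2
        rw [pow_add] at this
        linarith
      refine hω (hreport ω _ (hL1.trans hi₀) rfl hres ?_ ?_)
      -- `L ≤ i₀` gives `q F > s/4 ≥ 100 r`; below, `i₀ ≤ L + 2` gives `q F ≤ 4 · s/2`.
      · refine (min_le_right _ _).trans ?_
        have : (1 / 2 : ℝ) ^ i₀ * nnz (freq S) ≤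
          (1 / 2) ^ leastLevel X s ω (freq S) * nnz (freq S) := by gcongr
        linarith
      · have : (1 / 2) ^ leastLevel X s ω (freq S) * (nnz (freq S) : ℝ) ≤
          4 * (1 / 2) ^ i₀ * nnz (freq S) := by gcongr
        linarith
    have h4 : (4 : ℝ) / s ≤ 1 / 100 := by
      rw [div_le_div_iff₀ (by linarith) (by norm_num)]
      linarith
    linarith

/-- The level is chosen by the same coins as the sample, so accuracy is required at all three
candidate levels at once. The failures add up to at most `0.01 + 0.01 + 0.12 < 1/3`. -/
theorem isApproxAlg_of_leastReport (hX : IsLevelFamily ℓ X) (hn : n < 2 ^ ℓ) {r : ℝ} {s : ℕ}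
    (hr : 1 ≤ r) (hs : 400 * r ≤ s) {streams : Set (UpdateStream n)}
    (hstreams : ∀ S ∈ streams, absFreq S ∈ freqVectors n m)
    (hA : ∀ S ∈ streams, uprob (fun ω => ¬ (leastLevel X s ω (freq S) ≤ ℓ →
      A.result ω S = leastReport X s ω (freq S))) ≤ 1 / 100)
    {g : ℕ → ℝ} {ε : ℝ} (hg : IsDecreasingFn g) (hε : 0 < ε) (hε1 : ε ≤ 1)
    (hσ : 1 ≤ sigma ε g m n) (hσr : (sigma ε g m n : ℝ) / ε ≤ r) :
    IsApproxAlg (A.mapOutput fun R => R.estimate g) g ε streams := by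
  intro S hS
  rw [StreamAlg.prob_eq_uprob]
  set f := freq S with hf
  have hfm : absVec f ∈ freqVectors n m := hstreams S hS
  have hs2 : 2 ≤ s := by
    have : (2 : ℝ) ≤ s := by linarith
    exact_mod_cast this
  have hs400 : (400 : ℝ) ≤ s := by linarith
  have hσ' : (sigma ε g m n : ℝ) ≤ r * ε := (div_le_iff₀ hε).1 hσr
  refine le_trans ?_ (one_sub_uprob_not_le _)
  set G := gsum g (absVec f) with hG
  change _ ≤ 1 - uprob (fun ω : A.Coins => ¬ ((1 - ε) * G ≤ (A.result ω S).estimate g ∧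
    (A.result ω S).estimate g ≤ (1 + ε) * G))
  have hG0 : 0 ≤ G := gsum_nonneg hg _
  set good : ℕ → A.Coins → Prop := fun i ω =>
    (1 - ε) * G ≤ ((1 / 2) ^ i)⁻¹ * gsum g (absVec (restrict X i ω f)) ∧
      ((1 / 2) ^ i)⁻¹ * gsum g (absVec (restrict X i ω f)) ≤ (1 + ε) * G with hgood
  have hest : ∀ ω : A.Coins, leastLevel X s ω f ≤ ℓ →
      (leastLevel X s ω f ≤ ℓ → A.result ω S = leastReport X s ω f) →
      good (leastLevel X s ω f) ω → ((1 - ε) * G ≤ (A.result ω S).estimate g ∧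
        (A.result ω S).estimate g ≤ (1 + ε) * G) := by
    intro ω hL hres h
    rw [hres hL]
    exact h
  rcases le_or_gt (nnz f) s with hF | hF
  · have : uprob (fun ω : A.Coins => ¬ ((1 - ε) * G ≤ (A.result ω S).estimate g ∧
        (A.result ω S).estimate g ≤ (1 + ε) * G)) ≤ 1 / 100 := by
      refine (uprob_mono fun ω hω hres => hω ?_).trans (hA S hS)
      have h0 : leastLevel X s ω f = 0 := leastLevel_eq_zero hX hF
      refine hest ω (by omega) hres ?_
      have hre : restrict X 0 ω f = f := by
        funext d
        simp [restrict, hX.zero]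
      rw [h0]
      simp only [hgood, hre, pow_zero, inv_one, one_mul, ← hG]
      constructor <;> nlinarith
    linarith
  · obtain ⟨i₀, hi₀, hlow, hmax, hw⟩ := exists_leastLevel_window hX hn hs2 f hF
    have hF4 : 4 * sigma ε g m n ≤ nnz f := by
      have h1 : (s : ℝ) < nnz f := by exact_mod_cast hF
      have h2 : (4 * sigma ε g m n : ℝ) ≤ nnz f := by nlinarith
      exact_mod_cast h2
    -- With `u = s/4` the bound `4r/u` is `16 r/s`, and `s ≥ 400 r`.
    have hlevel : ∀ i ≤ i₀, uprob (fun ω => ¬ good i ω) ≤ 4 / 100 := by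
      intro i hi
      have hpow : ((1 : ℝ) / 2) ^ i₀ ≤ (1 / 2) ^ i :=
        pow_le_pow_of_le_one (by norm_num) (by norm_num) hi
      refine (uprob_estimate_restrict_le hX hg hε hσ hσ' f hfm hF4 (hi.trans hi₀)
        (u := s / 4) (by linarith) (hlow.le.trans (by gcongr))).trans ?_
      rw [div_le_div_iff₀ (by linarith) (by norm_num)]
      linarith
    have hthree : uprob (fun ω => ∃ i ∈ Finset.Icc (i₀ - 2) i₀, ¬ good i ω) ≤ 12 / 100 := by
      refine (uprob_exists_le _ _).trans ?_
      refine (Finset.sum_le_card_nsmul _ _ (4 / 100) fun i hi =>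
        hlevel i (Finset.mem_Icc.1 hi).2).trans ?_
      have : (Finset.Icc (i₀ - 2) i₀).card ≤ 3 := by
        rw [Nat.card_Icc]
        omega
      have h3 : (((Finset.Icc (i₀ - 2) i₀).card : ℕ) : ℝ) ≤ 3 := by exact_mod_cast this
      rw [nsmul_eq_mul]
      linarith
    have : uprob (fun ω : A.Coins => ¬ ((1 - ε) * G ≤ (A.result ω S).estimate g ∧
        (A.result ω S).estimate g ≤ (1 + ε) * G)) ≤ 1 / 100 + (4 / s + 12 / 100) := by
      refine (uprob_mono fun ω hω => ?_).trans ((uprob_or_le _ _).trans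
        (add_le_add (hA S hS) ((uprob_or_le _ _).trans (add_le_add hw hthree))))
      by_contra hcon
      rw [not_or, not_or, not_not, not_not] at hcon
      obtain ⟨hres, ⟨hL1, hL2⟩, hgd⟩ := hcon
      refine hω (hest ω (hL1.trans hi₀) hres ?_)
      by_contra hbad
      exact hgd ⟨_, Finset.mem_Icc.2 ⟨by omega, hL1⟩, hbad⟩
    have h4 : (4 : ℝ) / s ≤ 1 / 100 := by
      rw [div_le_div_iff₀ (by linarith) (by norm_num)]
      linarith
    linarith

theorem isUniversalSketch_of_leastReport (hX : IsLevelFamily ℓ X) (hn : n < 2 ^ ℓ) {r C : ℝ}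
    {s : ℕ} (hn1 : 1 ≤ n) (hm : 1 ≤ m) (hr : 1 ≤ r) (hs : 400 * r ≤ s) (hC : 2 * s ≤ C * r)
    {streams : Set (UpdateStream n)}
    (hstreams : ∀ S ∈ streams, absFreq S ∈ freqVectors n m)
    (hA : ∀ S ∈ streams, uprob (fun ω => ¬ (leastLevel X s ω (freq S) ≤ ℓ →
      A.result ω S = leastReport X s ω (freq S))) ≤ 1 / 100) :
    IsUniversalSketch A m r C streams :=
  ⟨samplesSupport_of_leastReport hX hn hr hs hC streams hA, fun _ _ hg hε hε1 hσ =>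
    isApproxAlg_of_leastReport hX hn hr hs hstreams hA hg hε hε1
      (one_le_sigma hg hε hε1 hn1 hm) hσ⟩

end universal

/-! ### Construction of nested pairwise independent levels from few fair coins -/

section sampler

variable {Ω Ω' : Type*} [Fintype Ω] [Fintype Ω'] {n ℓ : ℕ} {X : ℕ → Fin n → Ω → Bool}

theorem IsLevelFamily.comp_equiv (hX : IsLevelFamily ℓ X) (e : Ω' ≃ Ω) :
    IsLevelFamily ℓ fun i d ω => X i d (e ω) where
  prob_one i hi d := by
    rw [← hX.prob_one i hi d, ← uprob_comp_equiv e]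
  prob_pair i hi d d' hd := by
    rw [← hX.prob_pair i hi d d' hd, ← uprob_comp_equiv e]
  anti i j d ω := hX.anti i j d (e ω)
  zero d ω := hX.zero d (e ω)
  top i d ω := hX.top i d (e ω)

theorem IsLevelFamily.comp_fst [Nonempty Ω'] (hX : IsLevelFamily ℓ X) :
    IsLevelFamily ℓ fun i d (ω : Ω × Ω') => X i d ω.1 where
  prob_one i hi d := (uprob_comp_fst fun ω => X i d ω = true).trans (hX.prob_one i hi d)
  prob_pair i hi d d' hd :=
    (uprob_comp_fst fun ω => X i d ω = true ∧ X i d' ω = true).trans (hX.prob_pair i hi d d' hd)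
  anti i j d ω := hX.anti i j d ω.1
  zero d ω := hX.zero d ω.1
  top i d ω := hX.top i d ω.1

theorem uprob_and_prod (E : Ω → Prop) (E' : Ω' → Prop) :
    uprob (fun ω : Ω × Ω' => E ω.1 ∧ E' ω.2) = uprob E * uprob E' := by
  classical
  have : (Finset.univ.filter fun ω : Ω × Ω' => E ω.1 ∧ E' ω.2) =
      (Finset.univ.filter E) ×ˢ (Finset.univ.filter E') := by
    ext; simp
  rw [uprob_eq_card, uprob_eq_card, uprob_eq_card, this, Finset.card_product, Fintype.card_prod]
  push_cast
  rw [mul_div_mul_comm]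

theorem uprob_fin_mul_pow_lt {i k : ℕ} (hi : i ≤ k) :
    uprob (fun v : Fin (2 ^ k) => (v : ℕ) * 2 ^ i < 2 ^ k) = (1 / 2) ^ i := by
  have h : ∀ v : Fin (2 ^ k), (v : ℕ) * 2 ^ i < 2 ^ k ↔ (v : ℕ) < 2 ^ (k - i) := by
    intro v
    have : 2 ^ k = 2 ^ (k - i) * 2 ^ i := by rw [← pow_add, Nat.sub_add_cancel hi]
    exact (iff_of_eq (congrArg _ this)).trans (Nat.mul_lt_mul_right (by positivity))
  simp only [h]
  rw [uprob_eq_card, Fin.card_filter_val_lt,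
    min_eq_right (Nat.pow_le_pow_right (by norm_num) (Nat.sub_le _ _)), Fintype.card_fin]
  push_cast
  rw [pow_sub₀ _ two_ne_zero hi]
  field_simp
  rw [← mul_pow]
  norm_num

/-- The levels determined by the affine functions over a finite field of size `2 ^ k`. -/
theorem isLevelFamily_affine {F : Type*} [Field F] [Fintype F] {n k : ℕ}
    (idx : F ≃ Fin (2 ^ k)) (x : Fin n ↪ F) :
    IsLevelFamily k fun i d (ω : F × F) =>
      decide (i ≤ k ∧ (idx (ω.1 * x d + ω.2) : ℕ) * 2 ^ i < 2 ^ k) where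
  prob_one i hi d := by
    -- A shear is a bijection of `F × F`, so the value at a single point is uniform.
    have hinj : Function.Injective fun ω : F × F => (ω.1 * x d + ω.2, ω.1) := by
      rintro ⟨a, b⟩ ⟨a', b'⟩ h
      simp only [Prod.mk.injEq] at h
      obtain ⟨h1, rfl⟩ := h
      simpa using h1
    have h := uprob_comp_equiv (Equiv.ofBijective _ (Finite.injective_iff_bijective.1 hinj))
      (fun ω : F × F => (idx ω.1 : ℕ) * 2 ^ i < 2 ^ k)
    rw [uprob_comp_fst (fun a : F => (idx a : ℕ) * 2 ^ i < 2 ^ k),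
      uprob_comp_equiv idx (fun v => (v : ℕ) * 2 ^ i < 2 ^ k), uprob_fin_mul_pow_lt hi] at h
    rw [← h]
    simp [hi]
  prob_pair i hi d d' hd := by
    -- An affine function is determined by its values at two distinct points, so the two values are
    -- independent and uniform.
    have hinj : Function.Injective fun ω : F × F => (ω.1 * x d + ω.2, ω.1 * x d' + ω.2) := by
      rintro ⟨a, b⟩ ⟨a', b'⟩ h
      simp only [Prod.mk.injEq] at h
      obtain ⟨h1, h2⟩ := h
      have hx : x d - x d' ≠ 0 := sub_ne_zero.2 fun h => hd (x.injective h)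
      have ha : a = a' := mul_right_cancel₀ hx (by linear_combination h1 - h2)
      subst ha
      simpa using h1
    have h := uprob_comp_equiv (Equiv.ofBijective _ (Finite.injective_iff_bijective.1 hinj))
      (fun ω : F × F => (idx ω.1 : ℕ) * 2 ^ i < 2 ^ k ∧ (idx ω.2 : ℕ) * 2 ^ i < 2 ^ k)
    rw [uprob_and_prod (fun a : F => (idx a : ℕ) * 2 ^ i < 2 ^ k)
        (fun a : F => (idx a : ℕ) * 2 ^ i < 2 ^ k),
      uprob_comp_equiv idx (fun v => (v : ℕ) * 2 ^ i < 2 ^ k), uprob_fin_mul_pow_lt hi] at h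
    rw [← h]
    simp [hi]
  anti i j d ω hij h := by
    rw [decide_eq_true_iff] at h ⊢
    refine ⟨hij.trans h.1, lt_of_le_of_lt ?_ h.2⟩
    gcongr
    norm_num
  zero d ω := by simp
  top i d ω h := by simp [Nat.not_le.2 h]

/-- In a field of size `2^k` a seed is exactly `2k` fair bits and the probabilities `2⁻ⁱ` are exact.
-/
theorem exists_isLevelFamily {n k : ℕ} (hk : k ≠ 0) (hn : n ≤ 2 ^ k) :
    ∃ X : ℕ → Fin n → Fin (2 ^ (2 * k)) → Bool, IsLevelFamily k X := by
  let F := GaloisField 2 k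
  let : Fintype F := Fintype.ofFinite F
  have hF : Fintype.card F = 2 ^ k := by
    rw [← Nat.card_eq_fintype_card]
    exact GaloisField.card 2 k hk
  have e : Fin (2 ^ (2 * k)) ≃ F × F := Fintype.equivOfCardEq (by
    rw [Fintype.card_prod, hF, Fintype.card_fin, two_mul, pow_add])
  have idx : F ≃ Fin (2 ^ k) := Fintype.equivOfCardEq (by rw [hF, Fintype.card_fin])
  exact ⟨_, (isLevelFamily_affine idx ((Fin.castLEEmb hn).trans idx.symm.toEmbedding)).comp_equiv e⟩

end sampler

/-! ### Integer measurements of sparse vectors -/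

section measurements

variable {n : ℕ}

/-- A nonzero integer vector may vanish modulo `p`; after division by the gcd of its entries it does
not, for any prime. -/
theorem exists_primitive {y : Fin n → ℤ} (hy : y ≠ 0) :
    ∃ c : ℤ, c ≠ 0 ∧ ∃ z : Fin n → ℤ, (∀ d, y d = c * z d) ∧
      ∀ p : ℕ, p.Prime → ∃ d, (z d : ZMod p) ≠ 0 := by
  obtain ⟨d₀, hd₀⟩ := Function.ne_iff.1 hy
  obtain ⟨z, hz, hz1⟩ := Finset.extract_gcd y (s := Finset.univ) ⟨d₀, Finset.mem_univ _⟩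
  refine ⟨Finset.univ.gcd y, fun h => hd₀ ?_, z, fun d => hz d (Finset.mem_univ d), ?_⟩
  · rw [hz d₀ (Finset.mem_univ _), h, zero_mul]
    rfl
  · intro p hp
    by_contra! h
    have : (p : ℤ) ∣ Finset.univ.gcd z :=
      Finset.dvd_gcd fun d _ => (ZMod.intCast_zmod_eq_zero_iff_dvd _ _).1 (h d)
    rw [hz1] at this
    exact (Nat.prime_iff_prime_int.1 hp).not_isUnit (isUnit_of_dvd_one this)

/-- Only the coefficients are reduced modulo `p`; the measurement is an exact integer, so `c` can be
cancelled before passing to `ZMod p`. -/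
theorem sum_mul_cast_eq_zero {p : ℕ} [NeZero p] (h : Fin n → ZMod p) {y z : Fin n → ℤ} {c : ℤ}
    (hc : c ≠ 0) (hyz : ∀ d, y d = c * z d) (hy : ∑ d, ((h d).val : ℤ) * y d = 0) :
    ∑ d, h d * (z d : ZMod p) = 0 := by
  have h1 : c * ∑ d, ((h d).val : ℤ) * z d = 0 := by
    rw [← hy, Finset.mul_sum]
    exact Finset.sum_congr rfl fun d _ => by rw [hyz]; ring
  have h2 := congrArg (Int.cast : ℤ → ZMod p) ((mul_eq_zero.1 h1).resolve_left hc)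
  simpa using h2

/-- The first `K` power sums of a vector with at most `K` nonzero entries, with coefficients
reduced modulo a prime, determine whether it vanishes. -/
theorem eq_zero_of_power_sums {p : ℕ} (hp : p.Prime) (hn : n ≤ p) {K : ℕ} {y : Fin n → ℤ}
    (hK : nnz y ≤ K)
    (h : ∀ j < K, ∑ d : Fin n, (((d : ℕ) : ZMod p) ^ j).val * y d = 0) : y = 0 := by
  classical
  have := Fact.mk hp
  by_contra hy
  obtain ⟨c, hc, z, hyz, hz⟩ := exists_primitive hy
  obtain ⟨d₀, hd₀⟩ := hz p hp
  have hpow : ∀ j < K, ∑ d : Fin n, ((d : ℕ) : ZMod p) ^ j * (z d : ZMod p) = 0 := fun j hj =>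
    sum_mul_cast_eq_zero _ hc hyz (h j hj)
  set T := Finset.univ.filter fun d => y d ≠ 0 with hT
  have hd₀T : d₀ ∈ T := by
    simp only [hT, Finset.mem_filter, Finset.mem_univ, true_and, hyz]
    exact mul_ne_zero hc fun h => hd₀ (by simp [h])
  -- `Q` vanishes on the support except at `d₀` and has degree below `K`, so combining the power
  -- sums with its coefficients isolates the entry at `d₀`.
  set Q : Polynomial (ZMod p) :=
    ∏ d ∈ T.erase d₀, (Polynomial.X - Polynomial.C ((d : ℕ) : ZMod p)) with hQ
  have hdeg : Q.natDegree < K := by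
    rw [hQ, Polynomial.natDegree_prod_of_monic _ _ fun d _ => Polynomial.monic_X_sub_C _]
    simp only [Polynomial.natDegree_X_sub_C, Finset.sum_const, smul_eq_mul, mul_one]
    rw [Finset.card_erase_of_mem hd₀T]
    have : 0 < T.card := Finset.card_pos.2 ⟨_, hd₀T⟩
    rw [nnz_eq_card, ← hT] at hK
    omega
  have hsum : ∑ d : Fin n, Q.eval ((d : ℕ) : ZMod p) * (z d : ZMod p) = 0 := by
    simp_rw [Polynomial.eval_eq_sum_range' hdeg, Finset.sum_mul]
    rw [Finset.sum_comm]
    refine Finset.sum_eq_zero fun j hj => ?_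
    simp_rw [mul_assoc]
    rw [← Finset.mul_sum, hpow j (Finset.mem_range.1 hj), mul_zero]
  have hcast : ∀ d d' : Fin n, ((d : ℕ) : ZMod p) = ((d' : ℕ) : ZMod p) → d = d' := by
    intro d d' h
    rw [ZMod.natCast_eq_natCast_iff', Nat.mod_eq_of_lt (d.2.trans_le hn),
      Nat.mod_eq_of_lt (d'.2.trans_le hn)] at h
    exact Fin.ext h
  rw [Finset.sum_eq_single d₀] at hsum
  · refine (mul_ne_zero ?_ hd₀) hsum
    rw [hQ, Polynomial.eval_prod, Finset.prod_ne_zero_iff]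
    intro d hd
    simp only [Polynomial.eval_sub, Polynomial.eval_X, Polynomial.eval_C]
    exact sub_ne_zero.2 fun h => (Finset.mem_erase.1 hd).1 (hcast _ _ h).symm
  · intro d _ hd
    by_cases hdT : d ∈ T
    · rw [hQ, Polynomial.eval_prod, Finset.prod_eq_zero (Finset.mem_erase.2 ⟨hd, hdT⟩), zero_mul]
      simp
    · have : z d = 0 := by
        simp only [hT, Finset.mem_filter, Finset.mem_univ, true_and, not_not, hyz] at hdT
        exact (mul_eq_zero.1 hdT).resolve_left hc
      simp [this]
  · simp

/-- A random evaluation modulo a prime detects a nonzero integer vector. -/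
theorem uprob_fingerprint_le {p : ℕ} (hp : p.Prime) {N : ℕ} (hN : N ≤ p) {y : Fin n → ℤ}
    (hy : y ≠ 0) :
    uprob (fun a : Fin N => ∑ d : Fin n, (((a : ℕ) : ZMod p) ^ (d : ℕ)).val * y d = 0) ≤
      (n : ℝ) / N := by
  classical
  have := Fact.mk hp
  obtain ⟨c, hc, z, hyz, hz⟩ := exists_primitive hy
  obtain ⟨d₀, hd₀⟩ := hz p hp
  -- A vanishing fingerprint makes the random point a root of this nonzero polynomial, which has at
  -- most `n` roots.
  set P : Polynomial (ZMod p) :=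
    ∑ d : Fin n, Polynomial.C (z d : ZMod p) * Polynomial.X ^ (d : ℕ) with hP
  have hP0 : P ≠ 0 := by
    intro h
    apply hd₀
    have := congrArg (fun R => Polynomial.coeff R d₀) h
    simp only [hP, Polynomial.finsetSum_coeff, Polynomial.coeff_C_mul, Polynomial.coeff_X_pow,
      Polynomial.coeff_zero] at this
    rw [Finset.sum_eq_single d₀] at this
    · simpa using this
    · intro d _ hd
      rw [if_neg fun h => hd (Fin.ext h.symm), mul_zero]
    · simp
  have hdeg : P.natDegree ≤ n := Polynomial.natDegree_sum_le_of_forall_le _ _ fun d _ =>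
    (Polynomial.natDegree_C_mul_X_pow_le _ _).trans d.2.le
  rw [uprob_eq_card, Fintype.card_fin]
  gcongr
  refine le_trans ?_ ((Multiset.toFinset_card_le P.roots).trans ((P.card_roots').trans hdeg))
  refine Finset.card_le_card_of_injOn (fun a : Fin N => ((a : ℕ) : ZMod p)) ?_ ?_
  · intro a ha
    simp only [Finset.coe_filter, Finset.mem_univ, true_and, Set.mem_ofPred_eq] at ha
    have h := sum_mul_cast_eq_zero _ hc hyz ha
    rw [Finset.mem_coe, Multiset.mem_toFinset, Polynomial.mem_roots hP0, Polynomial.IsRoot.def]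
    simp only [hP, Polynomial.eval_finsetSum, Polynomial.eval_mul, Polynomial.eval_C,
      Polynomial.eval_pow, Polynomial.eval_X]
    rw [← h]
    exact Finset.sum_congr rfl fun d _ => mul_comm _ _
  · intro a _ b _ h
    simp only at h
    rw [ZMod.natCast_eq_natCast_iff', Nat.mod_eq_of_lt (a.2.trans_le hN),
      Nat.mod_eq_of_lt (b.2.trans_le hN)] at h
    exact Fin.ext h

end measurements

/-! ### The linear sketch for turnstile streams -/

/-- An injection of the integers into the natural numbers. -/
def zigzag (z : ℤ) : ℕ := 2 * z.natAbs + if z < 0 then 1 else 0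

theorem zigzag_injective : Function.Injective zigzag := by
  intro a b h
  unfold zigzag at h
  split_ifs at h <;> omega

theorem zigzag_le (z : ℤ) : zigzag z ≤ 2 * z.natAbs + 1 := by
  unfold zigzag
  split_ifs <;> omega

theorem map_univ_toList_injective {ι α : Type*} [Fintype ι] :
    Function.Injective fun f : ι → α => (Finset.univ : Finset ι).toList.map f := by
  intro f f' h
  funext i
  exact List.map_inj_left.1 h i (by simp)

theorem sum_map_le_card_mul {α : Type*} (l : List α) (f : α → ℕ) (b : ℕ)
    (h : ∀ x ∈ l, f x ≤ b) : (l.map f).sum ≤ l.length * b := by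
  have := List.sum_le_card_nsmul (l.map f) b (by simpa using h)
  simpa using this

theorem restrict_freq_append_singleton {Ω : Type*} {n : ℕ} (X : ℕ → Fin n → Ω → Bool) (i : ℕ)
    (ω : Ω) (S : UpdateStream n) (u : Fin n × ℤ) :
    restrict X i ω (freq (S ++ [u])) = restrict X i ω (freq S) +
      Pi.single u.1 (if X i u.1 ω = true then u.2 else 0) := by
  funext d
  simp only [restrict, freq_append_singleton, Pi.add_apply, Pi.single_apply]
  by_cases hd : u.1 = d
  · subst hd
    split_ifs <;> simp
  · rw [if_neg hd, if_neg (Ne.symm hd)]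
    simp

section turnstile

variable {n k K s t : ℕ}

/-- The coefficients of the linear measurements: powers modulo `p` of the item for `j < K`, and
powers of the random point `a` for the fingerprint `j = K`. -/
def coeff (p K a j d : ℕ) : ℤ :=
  if j < K then (((d : ZMod p) ^ j).val : ℤ) else (((a : ZMod p) ^ d).val : ℤ)

/-- The linear measurements of a vector. -/
def measurement (p K a : ℕ) (f : Fin n → ℤ) (j : ℕ) : ℤ := ∑ d : Fin n, coeff p K a j d * f d

theorem measurement_sub (p K a : ℕ) (f f' : Fin n → ℤ) (j : ℕ) :
    measurement p K a (f - f') j = measurement p K a f j - measurement p K a f' j := by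
  simp [measurement, mul_sub]

theorem natAbs_measurement_le {p : ℕ} (hp : p.Prime) (a : ℕ) {f : Fin n → ℤ} (j : ℕ) {M : ℕ}
    (hf : ∀ d, (f d).natAbs ≤ M) : (measurement p K a f j).natAbs ≤ n * (p * M) := by
  have := Fact.mk hp
  unfold measurement
  refine (Int.natAbs_sum_le _ _).trans ?_
  refine (Finset.sum_le_card_nsmul _ _ (p * M) fun d _ => ?_).trans (by simp)
  rw [Int.natAbs_mul]
  refine Nat.mul_le_mul ?_ (hf d)
  unfold coeff
  split_ifs <;> exact (ZMod.val_lt _).le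

/-- The states of the sketch: the seeds of the sampling levels and of the fingerprint, and the
counters of all the levels. -/
abbrev TurnstileState (k K t : ℕ) : Type :=
  (Fin (2 ^ (2 * k)) × Fin (2 ^ t)) × (Fin (k + 1) → Fin (K + 1) → ℤ)

/-- The update of the counters. -/
def turnstileStep (X : ℕ → Fin n → Fin (2 ^ (2 * k)) → Bool) (p : ℕ)
    (x : TurnstileState k K t) (u : Fin n × ℤ) : TurnstileState k K t :=
  (x.1, fun i j => x.2 i j + coeff p K x.1.2 j u.1 * if X i u.1 x.1.1 = true then u.2 else 0)

/-- The list of natural numbers through which a state is stored. -/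
noncomputable def turnstileCode (x : TurnstileState k K t) : List ℕ :=
  (x.1.1 : ℕ) :: (x.1.2 : ℕ) ::
    (Finset.univ : Finset (Fin (k + 1) × Fin (K + 1))).toList.map fun y => zigzag (x.2 y.1 y.2)

/-- The vector `v` is `s`-sparse and consistent with the counters of level `i`. -/
def IsConsistent (p s : ℕ) (x : TurnstileState k K t) (i : ℕ) (v : Fin n → ℤ) : Prop :=
  nnz v ≤ s ∧ ∀ j : Fin (K + 1), measurement p K x.1.2 v j = x.2 (Fin.ofNat (k + 1) i) j

open Classical in
/-- The report: the least level with a consistent `s`-sparse vector, and such a vector. -/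
noncomputable def turnstileOutput (n p s : ℕ) (x : TurnstileState k K t) : SampleReport n :=
  let i := sInf {i | i ≤ k ∧ ∃ v : Fin n → ℤ, IsConsistent p s x i v}
  ⟨(1 / 2) ^ i, Classical.epsilon (IsConsistent p s x i)⟩

/-- The sketch for turnstile streams. -/
noncomputable def turnstileAlg (X : ℕ → Fin n → Fin (2 ^ (2 * k)) → Bool) (p s K : ℕ)
    (e : (Fin (2 * k + t) → Bool) ≃ Fin (2 ^ (2 * k)) × Fin (2 ^ t)) :
    StreamAlg n (SampleReport n) :=
  StreamAlg.ofState (St := TurnstileState k K t) (2 * k + t) (fun ω => (e ω, 0))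
    (turnstileStep X p) (turnstileOutput n p s) turnstileCode

theorem turnstileCode_injective :
    Function.Injective (turnstileCode : TurnstileState k K t → List ℕ) := by
  rintro ⟨⟨a, b⟩, c⟩ ⟨⟨a', b'⟩, c'⟩ h
  simp only [turnstileCode, List.cons.injEq] at h
  obtain ⟨h1, h2, h3⟩ := h
  have h4 := map_univ_toList_injective h3
  rw [Fin.ext h1, Fin.ext h2]
  congr 1
  funext i j
  exact zigzag_injective (congrFun h4 (i, j))

/-- By linearity the counters depend only on the current frequency vector and the seeds, so
deletions do no harm. -/
theorem foldl_turnstileStep (X : ℕ → Fin n → Fin (2 ^ (2 * k)) → Bool) (p : ℕ)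
    (σ : Fin (2 ^ (2 * k)) × Fin (2 ^ t)) (S : UpdateStream n) :
    S.foldl (turnstileStep X p) ((σ, 0) : TurnstileState k K t) =
      (σ, fun (i : Fin (k + 1)) (j : Fin (K + 1)) =>
        measurement p K σ.2 (restrict X i σ.1 (freq S)) j) := by
  induction S using List.reverseRecOn with
  | nil =>
    refine Prod.ext rfl ?_
    funext i j
    simp [measurement, restrict, freq]
  | append_singleton S u ih =>
    rw [List.foldl_append, ih]
    refine Prod.ext rfl ?_
    funext i j
    simp only [List.foldl_cons, List.foldl_nil, turnstileStep,
      restrict_freq_append_singleton, measurement, Pi.add_apply,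
      mul_add, Finset.sum_add_distrib, Pi.single_apply]
    congr 1
    simp

/-- At all levels, the sampled part of `f` is the only `s`-sparse vector with its measurements. -/
def IsDecodable (X : ℕ → Fin n → Fin (2 ^ (2 * k)) → Bool) (p s K : ℕ)
    (σ : Fin (2 ^ (2 * k)) × Fin (2 ^ t)) (f : Fin n → ℤ) : Prop :=
  ∀ i < k + 1, ∀ v : Fin n → ℤ, nnz v ≤ s →
    (∀ j < K + 1, measurement p K σ.2 v j = measurement p K σ.2 (restrict X i σ.1 f) j) →
    v = restrict X i σ.1 f

/-- Under decodability a level has a consistent sparse vector only if its sample is `s`-sparse, so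
the search stops at the least level with the true sample. -/
theorem turnstileOutput_eq {X : ℕ → Fin n → Fin (2 ^ (2 * k)) → Bool} (hX : IsLevelFamily k X)
    {p : ℕ} {σ : Fin (2 ^ (2 * k)) × Fin (2 ^ t)} {f : Fin n → ℤ}
    (hd : IsDecodable X p s K σ f) (hL : leastLevel X s σ.1 f ≤ k) :
    turnstileOutput n p s ((σ, fun i j => measurement p K σ.2 (restrict X i σ.1 f) j) :
      TurnstileState k K t) = leastReport X s σ.1 f := by
  set x : TurnstileState k K t :=
    (σ, fun i j => measurement p K σ.2 (restrict X i σ.1 f) j) with hx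
  have hcons : ∀ i ≤ k, ∀ v, IsConsistent p s x i v → v = restrict X i σ.1 f := by
    rintro i hi v ⟨h1, h2⟩
    refine hd i (by omega) v h1 fun j hj => ?_
    have := h2 ⟨j, hj⟩
    -- `Fin.ofNat` reduces modulo `k + 1`, which changes nothing for `i ≤ k`.
    simpa [hx, Fin.ofNat, Nat.mod_eq_of_lt (Nat.lt_succ_of_le hi)] using this
  set L := leastLevel X s σ.1 f with hLdef
  have hself : IsConsistent p s x L (restrict X L σ.1 f) := by
    refine ⟨nnz_restrict_leastLevel_le hX s σ.1 f, fun j => ?_⟩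
    simp [hx, Fin.ofNat, Nat.mod_eq_of_lt (Nat.lt_succ_of_le hL)]
  have hinf : sInf {i | i ≤ k ∧ ∃ v : Fin n → ℤ, IsConsistent p s x i v} = L := by
    refine le_antisymm (Nat.sInf_le ⟨hL, _, hself⟩) (le_csInf ⟨L, hL, _, hself⟩ ?_)
    rintro i ⟨hi, v, hv⟩
    refine leastLevel_le ?_
    rw [← hcons i hi v hv]
    exact hv.1
  unfold turnstileOutput leastReport
  rw [hinf]
  dsimp only
  congr 1
  exact hcons L hL _ (Classical.epsilon_spec ⟨_, hself⟩)

theorem uprob_not_isDecodable_le (X : ℕ → Fin n → Fin (2 ^ (2 * k)) → Bool) {p : ℕ}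
    (hp : p.Prime) (hn : n ≤ p) (ht : 2 ^ t ≤ p) (f : Fin n → ℤ) :
    uprob (fun σ : Fin (2 ^ (2 * k)) × Fin (2 ^ t) => ¬ IsDecodable X p s (2 * s) σ f) ≤
      (k + 1) * (n / 2 ^ t) := by
  refine uprob_le_of_forall_fst (by positivity) _ fun h => ?_
  have hlevel : ∀ i, uprob (fun a : Fin (2 ^ t) => ∃ v : Fin n → ℤ, nnz v ≤ s ∧
      (∀ j < 2 * s + 1, measurement p (2 * s) a v j =
        measurement p (2 * s) a (restrict X i h f) j) ∧ v ≠ restrict X i h f) ≤ n / 2 ^ t := by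
    intro i
    set y := restrict X i h f with hy
    -- The power sums do not involve the point `a`; writing `0` for it makes the candidate visibly
    -- independent of `a`.
    by_cases hex : ∃ v₀ : Fin n → ℤ, nnz v₀ ≤ s ∧
        (∀ j < 2 * s, measurement p (2 * s) 0 v₀ j = measurement p (2 * s) 0 y j) ∧ v₀ ≠ y
    · obtain ⟨v₀, hv₀, hm₀, hne⟩ := hex
      have hfp := uprob_fingerprint_le hp ht (sub_ne_zero.2 hne)
      push_cast at hfp
      refine (uprob_mono fun a => ?_).trans hfp
      rintro ⟨v, hv, hm, -⟩
      have hlow : ∀ (w : Fin n → ℤ), ∀ j < 2 * s,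
          measurement p (2 * s) a w j = measurement p (2 * s) 0 w j := by
        intro w j hj
        simp only [measurement, coeff, if_pos hj]
      -- The difference of two `s`-sparse vectors is `2s`-sparse, hence `K = 2s` power sums.
      have hvv : v - v₀ = 0 := by
        refine eq_zero_of_power_sums hp hn (K := 2 * s) ?_ fun j hj => ?_
        · rw [nnz_eq_card] at *
          refine le_trans (Finset.card_le_card (t := (Finset.univ.filter fun d => v d ≠ 0) ∪
            (Finset.univ.filter fun d => v₀ d ≠ 0)) fun d => ?_)
            ((Finset.card_union_le _ _).trans (by omega))
          simp only [Finset.mem_filter, Finset.mem_univ, true_and, Finset.mem_union,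
            Pi.sub_apply]
          intro h1
          by_contra! h2
          exact h1 (by rw [h2.1, h2.2, sub_zero])
        · have h1 : measurement p (2 * s) 0 (v - v₀) j = 0 := by
            rw [measurement_sub, hm₀ j hj, ← hlow v j hj, hm j (by omega), hlow y j hj, sub_self]
          simpa only [measurement, coeff, if_pos hj] using h1
      have hv' : v = v₀ := sub_eq_zero.1 hvv
      subst hv'
      have h1 : measurement p (2 * s) a (v - y) (2 * s) = 0 := by
        rw [measurement_sub, hm _ (by omega), sub_self]
      simpa only [measurement, coeff, lt_irrefl, if_false] using h1
    · refine (uprob_mono (E' := fun _ => False) fun a => ?_).trans ?_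
      · rintro ⟨v, hv, hm, hne⟩
        refine hex ⟨v, hv, fun j hj => ?_, hne⟩
        have := hm j (by omega)
        simpa only [measurement, coeff, if_pos hj] using this
      · simp only [uprob, Finset.filter_false, Finset.card_empty, Nat.cast_zero, zero_div]
        positivity
  refine (uprob_mono fun a ha => ?_).trans ((uprob_exists_le (Finset.range (k + 1))
    fun i (a : Fin (2 ^ t)) => ∃ v : Fin n → ℤ, nnz v ≤ s ∧
      (∀ j < 2 * s + 1, measurement p (2 * s) a v j =
        measurement p (2 * s) a (restrict X i h f) j) ∧ v ≠ restrict X i h f).trans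
      ((Finset.sum_le_card_nsmul _ _ _ fun i _ => hlevel i).trans (by simp)))
  unfold IsDecodable at ha
  push Not at ha
  obtain ⟨i, hi, v, hv, hm, hne⟩ := ha
  exact ⟨i, Finset.mem_range.2 hi, v, hv, hm, hne⟩

theorem storage_turnstileAlg_le {X : ℕ → Fin n → Fin (2 ^ (2 * k)) → Bool} {p : ℕ}
    (hp : p.Prime) (hn : 2 ≤ n) {c : ℕ}
    (e : (Fin (2 * k + t) → Bool) ≃ Fin (2 ^ (2 * k)) × Fin (2 ^ t)) (S : UpdateStream n)
    (hpM : p ≤ maxFreq S ^ c) :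
    (turnstileAlg X p s K e).storage S ≤
      4 * k + 2 * t + 2 + (k + 1) * (K + 1) * (2 * ((c + 4) * (maxFreq S).size) + 1) := by
  set M := maxFreq S with hM
  have hnM : n ≤ M := le_maxFreq S
  refine StreamAlg.storage_ofState_le turnstileCode_injective S _ fun ω l => ?_
  rw [foldl_turnstileStep]
  simp only [turnstileCode, List.map_cons, List.sum_cons, List.map_map]
  have h1 : ((e ω).1 : ℕ).size ≤ 2 * k := Nat.size_le.2 (e ω).1.2
  have h2 : ((e ω).2 : ℕ).size ≤ t := Nat.size_le.2 (e ω).2.2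
  refine (Nat.add_le_add_left (Nat.add_le_add_left (sum_map_le_card_mul _ _
    (2 * ((c + 4) * M.size) + 1) fun y _ => ?_) _) _).trans ?_
  · simp only [Function.comp_apply]
    have hb : (measurement p K (e ω).2 (restrict X y.1 (e ω).1 (freq (S.take l))) y.2).natAbs ≤
        M ^ (c + 2) := by
      refine (natAbs_measurement_le hp _ _ (M := M) fun d => ?_).trans ?_
      · unfold restrict
        split_ifs
        · exact absFreq_take_le_maxFreq S l d
        · simp
      · calc n * (p * M) ≤ M * (M ^ c * M) := by gcongr
          _ = M ^ (c + 2) := by ring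
    have hz := zigzag_le (measurement p K (e ω).2 (restrict X y.1 (e ω).1 (freq (S.take l))) y.2)
    have hsz := size_le_of_le_pow (x := zigzag (measurement p K (e ω).2
      (restrict X y.1 (e ω).1 (freq (S.take l))) y.2)) (M := M) (e := c + 4) (by omega) (by
        -- The sign coding at most doubles a counter and adds one; two more powers of `M ≥ 2` absorb
        -- this.
        have h4 : 4 * M ^ (c + 2) ≤ M ^ (c + 4) := by
          have : 4 ≤ M ^ 2 := by nlinarith
          calc 4 * M ^ (c + 2) ≤ M ^ 2 * M ^ (c + 2) := by gcongr
            _ = M ^ (c + 4) := by ring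
        have h5 : 1 ≤ M ^ (c + 2) := Nat.one_le_pow _ _ (by omega)
        omega)
    omega
  · simp only [Finset.length_toList, Finset.card_univ, Fintype.card_prod, Fintype.card_fin]
    omega

theorem exists_turnstile_sketch {n m : ℕ} (hn : 2 ≤ n) (hm : n ≤ m) {r : ℝ} (hr : 1 ≤ r) :
    ∃ A : StreamAlg n (SampleReport n),
      (∀ S : UpdateStream n, (A.storage S : ℝ) ≤
        10 ^ 7 * (r * Real.log n ^ 2 * Real.log (maxFreq S))) ∧
      IsUniversalSketch A m r (10 ^ 7) (turnstileStreams n m) := by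
  set k := n.size with hk
  have hk2 : 2 ≤ k := Nat.lt_size.2 (by simpa using hn)
  have hnk : n < 2 ^ k := Nat.lt_size_self n
  have hkn : 2 ^ k ≤ 2 * n := by
    have h1 : 2 ^ (k - 1) ≤ n := Nat.lt_size.1 (by omega)
    calc 2 ^ k = 2 * 2 ^ (k - 1) := by rw [← pow_succ']; congr 1; omega
      _ ≤ 2 * n := by omega
  -- Since `(k + 1) n ≤ 2^(2k)`, the decoding failure `(k + 1) n / 2^t` is at most `1/128`.
  set t := 2 * k + 7 with ht
  obtain ⟨p, hp, htp, hpt⟩ := Nat.exists_prime_lt_and_le_two_mul (2 ^ t) (by positivity)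
  have hnp : n ≤ p := (hnk.le.trans (Nat.pow_le_pow_right (by norm_num) (by omega))).trans htp.le
  obtain ⟨X, hX⟩ := exists_isLevelFamily (n := n) (k := k) (by omega) hnk.le
  set s := ⌈400 * r⌉₊ with hs
  have hs1 : 400 * r ≤ s := Nat.le_ceil _
  have hs2 : (s : ℝ) ≤ 401 * r := by
    have := Nat.ceil_lt_add_one (a := 400 * r) (by linarith)
    rw [← hs] at this
    linarith
  have e : (Fin (2 * k + t) → Bool) ≃ Fin (2 ^ (2 * k)) × Fin (2 ^ t) :=
    Fintype.equivOfCardEq (by simp [pow_add])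
  refine ⟨turnstileAlg X p s (2 * s) e, fun S => ?_, ?_⟩
  · set M := maxFreq S with hM
    have hnM : n ≤ M := le_maxFreq S
    have hpM : p ≤ M ^ 12 := by
      calc p ≤ 2 * 2 ^ t := hpt
        _ = 2 ^ 8 * (2 ^ k) ^ 2 := by rw [ht, pow_add, pow_mul']; ring
        _ ≤ 2 ^ 8 * (2 * M) ^ 2 := by gcongr; omega
        _ = 2 ^ 10 * M ^ 2 := by ring
        _ ≤ M ^ 10 * M ^ 2 := by gcongr; omega
        _ = M ^ 12 := by ring
    have h := storage_turnstileAlg_le (X := X) (s := s) (K := 2 * s) hp hn e S hpM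
    have hΛ1 : 1 ≤ M.size := Nat.size_pos.2 (by omega)
    have hs0 : 1 ≤ s := by
      have : (1 : ℝ) ≤ s := by linarith
      exact_mod_cast this
    have hB : (turnstileAlg X p s (2 * s) e).storage S ≤ 222 * k * s * M.size := by
      refine h.trans ?_
      have e1 : 4 * k + 2 * t + 2 ≤ 16 * k := by omega
      have e2 : (k + 1) * (2 * s + 1) * (2 * ((12 + 4) * M.size) + 1) ≤
          (2 * k) * (3 * s) * (33 * M.size) := by gcongr <;> omega
      have e3 : 16 * k ≤ 16 * k * s * M.size := by
        have := Nat.mul_le_mul (Nat.mul_le_mul_left (16 * k) hs0) hΛ1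
        simpa using this
      nlinarith
    have hB' : ((turnstileAlg X p s (2 * s) e).storage S : ℝ) ≤ 222 * k * s * M.size := by
      exact_mod_cast hB
    have hkl : (k : ℝ) ≤ 3 * Real.log n := size_le_three_mul_log hn
    have hMl : (M.size : ℝ) ≤ 3 * Real.log M := size_le_three_mul_log (hn.trans hnM)
    have hlog2 := Real.log_two_gt_d9
    have hln : Real.log 2 ≤ Real.log n := Real.log_le_log (by norm_num) (by exact_mod_cast hn)
    have hlM : 0 ≤ Real.log M := Real.log_natCast_nonneg _
    -- The count of levels gives a single factor `log n`; as `log n ≥ log 2 > 1/2`, it is below the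
    -- claimed square up to a constant.
    have hln2 : Real.log n ≤ 2 * Real.log n ^ 2 := by nlinarith
    calc ((turnstileAlg X p s (2 * s) e).storage S : ℝ) ≤ 222 * k * s * M.size := hB'
      _ ≤ 222 * (3 * Real.log n) * (401 * r) * (3 * Real.log M) := by gcongr
      _ = 801198 * r * Real.log M * Real.log n := by ring
      _ ≤ 801198 * r * Real.log M * (2 * Real.log n ^ 2) := by gcongr
      _ = 1602396 * (r * Real.log n ^ 2 * Real.log M) := by ring
      _ ≤ 10 ^ 7 * (r * Real.log n ^ 2 * Real.log M) := by gcongr; norm_num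
  · have hXA : IsLevelFamily (Ω := (turnstileAlg X p s (2 * s) e).Coins) k
        fun i d ω => X i d (e ω).1 := hX.comp_fst.comp_equiv e
    refine isUniversalSketch_of_leastReport hXA hnk (by omega) (by omega) hr hs1 (by linarith)
      (fun S hS => hS) fun S _ => ?_
    have hdec := uprob_not_isDecodable_le (s := s) X hp hnp htp.le (freq S)
    have hbound : ((k : ℝ) + 1) * (n / 2 ^ t) ≤ 1 / 100 := by
      have h1 : (k + 1) * n * 100 ≤ 2 ^ t := by
        have h2 : k + 1 ≤ 2 ^ k := Nat.lt_two_pow_self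
        calc (k + 1) * n * 100 ≤ 2 ^ k * 2 ^ k * 2 ^ 7 := by
              gcongr
              norm_num
          _ = 2 ^ t := by rw [ht]; ring
      have h1' : ((k : ℝ) + 1) * n * 100 ≤ 2 ^ t := by exact_mod_cast h1
      rw [← mul_div_assoc, div_le_div_iff₀ (by positivity) (by norm_num)]
      linarith
    refine le_trans (le_trans (uprob_mono (Ω := Fin (2 * k + t) → Bool)
      (E' := fun ω => ¬ IsDecodable X p s (2 * s) (e ω) (freq S)) fun ω hω hd => hω fun hL => ?_)
      (uprob_comp_equiv e fun σ => ¬ IsDecodable X p s (2 * s) σ (freq S)).le)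
      (hdec.trans hbound)
    refine (StreamAlg.result_ofState turnstileCode_injective ω S).trans ?_
    rw [foldl_turnstileStep]
    exact turnstileOutput_eq hX hd hL

end turnstile

/-! ### The sampling algorithm for insertion-only streams -/

section insertion

variable {n k s : ℕ}

theorem freq_nonneg_of_insertion {S : UpdateStream n} (hS : ∀ u ∈ S, u.2 = 1) (d : Fin n) :
    0 ≤ freq S d := by
  refine List.sum_nonneg fun x hx => ?_
  obtain ⟨u, hu, rfl⟩ := List.mem_map.1 hx
  split_ifs
  · simp [hS u hu]
  · exact le_rfl

/-- The states of the algorithm: the seed, the current level and the frequencies of the items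
sampled at that level. -/
abbrev InsertionState (n k : ℕ) : Type := Fin (2 ^ (2 * k)) × ℕ × (Fin n → ℤ)

/-- Count the update if its item is sampled at the current level, then raise the level until at
most `s` items are kept. -/
noncomputable def insertionStep (X : ℕ → Fin n → Fin (2 ^ (2 * k)) → Bool) (s : ℕ)
    (x : InsertionState n k) (u : Fin n × ℤ) : InsertionState n k :=
  let w := x.2.2 + Pi.single u.1 (if X x.2.1 u.1 x.1 = true then u.2 else 0)
  let i := sInf {i | x.2.1 ≤ i ∧ nnz (restrict X i x.1 w) ≤ s}
  (x.1, i, restrict X i x.1 w)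

/-- The list of natural numbers through which a state is stored. -/
noncomputable def insertionCode (x : InsertionState n k) : List ℕ :=
  (x.1 : ℕ) :: x.2.1 ::
    (vsupp (absVec x.2.2)).toList.map fun d : Fin n => Nat.pair d (zigzag (x.2.2 d))

/-- The sampling algorithm for insertion-only streams. -/
noncomputable def insertionAlg (X : ℕ → Fin n → Fin (2 ^ (2 * k)) → Bool) (s : ℕ)
    (e : (Fin (2 * k) → Bool) ≃ Fin (2 ^ (2 * k))) : StreamAlg n (SampleReport n) :=
  StreamAlg.ofState (St := InsertionState n k) (2 * k) (fun ω => (e ω, 0, 0))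
    (insertionStep X s) (fun x => ⟨(1 / 2) ^ x.2.1, x.2.2⟩) insertionCode

theorem insertionCode_injective :
    Function.Injective (insertionCode : InsertionState n k → List ℕ) := by
  rintro ⟨a, i, w⟩ ⟨a', i', w'⟩ h
  simp only [insertionCode, List.cons.injEq] at h
  obtain ⟨h1, h2, h3⟩ := h
  have key : ∀ v v' : Fin n → ℤ,
      ((vsupp (absVec v)).toList.map fun d : Fin n => Nat.pair d (zigzag (v d))) =
        ((vsupp (absVec v')).toList.map fun d : Fin n => Nat.pair d (zigzag (v' d))) →
      ∀ d, v d ≠ 0 → v' d = v d := by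
    intro v v' h d hd
    have hmem : Nat.pair d (zigzag (v d)) ∈
        (vsupp (absVec v)).toList.map fun d : Fin n => Nat.pair d (zigzag (v d)) :=
      List.mem_map.2 ⟨d, by simpa [vsupp, absVec] using hd, rfl⟩
    rw [h] at hmem
    obtain ⟨d', -, hd'⟩ := List.mem_map.1 hmem
    obtain ⟨h1, h2⟩ := Nat.pair_eq_pair.1 hd'
    rw [← Fin.ext h1]
    rw [← Fin.ext h1] at h2
    exact zigzag_injective h2
  have hw : w = w' := by
    funext d
    by_cases hd : w d = 0
    · by_cases hd' : w' d = 0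
      · rw [hd, hd']
      · exact key w' w h3.symm d hd'
    · exact (key w w' h3 d hd).symm
  rw [Fin.ext h1, h2, hw]

/-- The level never has to decrease, and by nesting an item sampled now was sampled at all earlier
levels, so none of its occurrences was missed. -/
theorem foldl_insertionStep {X : ℕ → Fin n → Fin (2 ^ (2 * k)) → Bool} (hX : IsLevelFamily k X)
    (s : ℕ) (σ : Fin (2 ^ (2 * k))) {S : UpdateStream n} (hS : ∀ u ∈ S, u.2 = 1) :
    S.foldl (insertionStep X s) ((σ, 0, 0) : InsertionState n k) =
      (σ, leastLevel X s σ (freq S), restrict X (leastLevel X s σ (freq S)) σ (freq S)) := by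
  induction S using List.reverseRecOn with
  | nil =>
    have h0 : freq ([] : UpdateStream n) = 0 := rfl
    have hr : ∀ i, restrict X i σ (0 : Fin n → ℤ) = 0 := by
      intro i
      funext d
      simp [restrict]
    have hL : leastLevel X s σ (freq ([] : UpdateStream n)) = 0 := by
      refine Nat.le_zero.1 (leastLevel_le ?_)
      rw [h0, hr, nnz_eq_card]
      simp
    rw [hL, h0, hr]
    rfl
  | append_singleton S u ih =>
    have hS' : ∀ v ∈ S, v.2 = 1 := fun v hv => hS v (List.mem_append_left _ hv)
    have hu : u.2 = 1 := hS u (by simp)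
    rw [List.foldl_append, ih hS']
    set L := leastLevel X s σ (freq S) with hL
    set f' := freq (S ++ [u]) with hf'
    have hw : restrict X L σ (freq S) +
        Pi.single u.1 (if X L u.1 σ = true then u.2 else 0) = restrict X L σ f' :=
      (restrict_freq_append_singleton X L σ S u).symm
    have hrr : ∀ j, L ≤ j → restrict X j σ (restrict X L σ f') = restrict X j σ f' := by
      intro j hj
      funext d
      unfold restrict
      by_cases h : X j d σ = true
      · rw [if_pos h, if_pos h, if_pos (hX.anti _ _ _ _ hj h)]
      · rw [if_neg h, if_neg h]
    -- Insertions cannot cancel: a level sparse enough for the longer stream was so for the shorter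
    -- one.
    have hLL : L ≤ leastLevel X s σ f' := by
      refine leastLevel_le ((nnz_mono fun d hd => ?_).trans
        (nnz_restrict_leastLevel_le hX s σ f'))
      unfold restrict at hd ⊢
      split_ifs at hd ⊢
      · rw [hf', freq_append_singleton]
        have := freq_nonneg_of_insertion hS' d
        split_ifs <;> omega
      · exact absurd rfl hd
    have hinf : sInf {i | L ≤ i ∧ nnz (restrict X i σ (restrict X L σ f')) ≤ s} =
        leastLevel X s σ f' := by
      have hmem := nnz_restrict_leastLevel_le hX s σ f'
      rw [← hrr _ hLL] at hmem
      refine le_antisymm (Nat.sInf_le ⟨hLL, hmem⟩) (le_csInf ⟨_, hLL, hmem⟩ ?_)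
      rintro i ⟨hi, hi'⟩
      rw [hrr i hi] at hi'
      exact leastLevel_le hi'
    simp only [List.foldl_cons, List.foldl_nil, insertionStep]
    rw [hw, hinf, hrr _ hLL]

theorem storage_insertionAlg_le {X : ℕ → Fin n → Fin (2 ^ (2 * k)) → Bool}
    (hX : IsLevelFamily k X) (hn : 2 ≤ n) (e : (Fin (2 * k) → Bool) ≃ Fin (2 ^ (2 * k)))
    {S : UpdateStream n} (hS : ∀ u ∈ S, u.2 = 1) :
    (insertionAlg X s e).storage S ≤ 6 * k + 4 + s * (12 * (maxFreq S).size + 1) := by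
  set M := maxFreq S with hM
  have hnM : n ≤ M := le_maxFreq S
  refine StreamAlg.storage_ofState_le insertionCode_injective S _ fun ω l => ?_
  rw [foldl_insertionStep hX s (e ω) fun u hu => hS u (List.mem_of_mem_take hu)]
  set f := freq (S.take l) with hf
  set L := leastLevel X s (e ω) f with hL
  simp only [insertionCode, List.map_cons, List.sum_cons, List.map_map]
  have h1 : ((e ω) : ℕ).size ≤ 2 * k := Nat.size_le.2 (e ω).2
  have hLk : L ≤ k + 1 := leastLevel_le (nnz_restrict_le_of_lt hX _ _ _ (Nat.lt_succ_self k))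
  have h2 : L.size ≤ k + 1 := Nat.size_le.2 (hLk.trans_lt Nat.lt_two_pow_self)
  have h3 : nnz (restrict X L (e ω) f) ≤ s := nnz_restrict_leastLevel_le hX s (e ω) f
  refine (Nat.add_le_add_left (Nat.add_le_add_left (sum_map_le_card_mul _ _
    (12 * M.size + 1) fun d _ => ?_) _) _).trans ?_
  · simp only [Function.comp_apply]
    have hz : zigzag (restrict X L (e ω) f d) ≤ 2 * M + 1 := by
      refine (zigzag_le _).trans ?_
      have : (restrict X L (e ω) f d).natAbs ≤ M := by
        unfold restrict
        split_ifs
        · exact absFreq_take_le_maxFreq S l d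
        · simp
      omega
    -- The pairing is below the square of the larger entry plus one, and both entries plus one are
    -- at most `4M ≤ M^3`.
    have hpair : Nat.pair d (zigzag (restrict X L (e ω) f d)) ≤ M ^ 6 := by
      refine (Nat.pair_lt_max_add_one_sq _ _).le.trans ?_
      have hmax : max (d : ℕ) (zigzag (restrict X L (e ω) f d)) + 1 ≤ M ^ 3 := by
        have h4 : 4 * M ≤ M ^ 3 := by
          have : 4 ≤ M ^ 2 := by nlinarith
          calc 4 * M ≤ M ^ 2 * M := by gcongr
            _ = M ^ 3 := by ring
        have := d.2
        rcases max_cases (d : ℕ) (zigzag (restrict X L (e ω) f d)) with h | h <;> omega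
      calc _ ≤ (M ^ 3) ^ 2 := by gcongr
        _ = M ^ 6 := by ring
    have := size_le_of_le_pow (by norm_num) hpair
    omega
  · rw [Finset.length_toList]
    have : (vsupp (absVec (restrict X L (e ω) f))).card * (12 * M.size + 1) ≤
      s * (12 * M.size + 1) := Nat.mul_le_mul_right _ h3
    omega

theorem exists_insertion_sketch {n m : ℕ} (hn : 2 ≤ n) (hm : n ≤ m) {r : ℝ} (hr : 1 ≤ r) :
    ∃ A : StreamAlg n (SampleReport n),
      (∀ S ∈ insertionStreams n m, (A.storage S : ℝ) ≤
        10 ^ 7 * (r * Real.log (maxFreq S) + Real.log n ^ 2)) ∧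
      IsUniversalSketch A m r (10 ^ 7) (insertionStreams n m) := by
  set k := n.size with hk
  have hk2 : 2 ≤ k := Nat.lt_size.2 (by simpa using hn)
  have hnk : n < 2 ^ k := Nat.lt_size_self n
  obtain ⟨X, hX⟩ := exists_isLevelFamily (n := n) (k := k) (by omega) hnk.le
  set s := ⌈400 * r⌉₊ with hs
  have hs1 : 400 * r ≤ s := Nat.le_ceil _
  have hs2 : (s : ℝ) ≤ 401 * r := by
    have := Nat.ceil_lt_add_one (a := 400 * r) (by linarith)
    rw [← hs] at this
    linarith
  have e : (Fin (2 * k) → Bool) ≃ Fin (2 ^ (2 * k)) := Fintype.equivOfCardEq (by simp)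
  refine ⟨insertionAlg X s e, fun S hS => ?_, ?_⟩
  · set M := maxFreq S with hM
    have hnM : n ≤ M := le_maxFreq S
    have h := storage_insertionAlg_le (s := s) hX hn e hS.2
    have hkM : k ≤ M.size := Nat.size_le_size hnM
    have hs0 : 1 ≤ s := by
      have : (1 : ℝ) ≤ s := by linarith
      exact_mod_cast this
    have hB : (insertionAlg X s e).storage S ≤ 21 * s * M.size := by
      refine h.trans ?_
      rw [← hM]
      -- The seed is no longer than a constant times `log M`, so it is absorbed by the counters; the
      -- `log² n` term is slack.
      have : k ≤ s * M.size := hkM.trans (Nat.le_mul_of_pos_left _ hs0)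
      have : s ≤ s * M.size := Nat.le_mul_of_pos_right _ (by omega)
      nlinarith
    have hB' : ((insertionAlg X s e).storage S : ℝ) ≤ 21 * s * M.size := by exact_mod_cast hB
    have hMl : (M.size : ℝ) ≤ 3 * Real.log M := size_le_three_mul_log (hn.trans hnM)
    have hlM : 0 ≤ Real.log M := Real.log_natCast_nonneg _
    calc ((insertionAlg X s e).storage S : ℝ) ≤ 21 * s * M.size := hB'
      _ ≤ 21 * (401 * r) * (3 * Real.log M) := by gcongr
      _ = 25263 * (r * Real.log M) := by ring
      _ ≤ 10 ^ 7 * (r * Real.log M) := by gcongr; norm_num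
      _ ≤ 10 ^ 7 * (r * Real.log M + Real.log n ^ 2) := by
        gcongr
        exact le_add_of_nonneg_right (sq_nonneg _)
  · have hXA : IsLevelFamily (Ω := (insertionAlg X s e).Coins) k
        fun i d ω => X i d (e ω) := hX.comp_equiv e
    refine isUniversalSketch_of_leastReport hXA hnk (by omega) (by omega) hr hs1 (by linarith)
      (fun S hS => hS.1) fun S hS => ?_
    refine (uprob_mono (Ω := Fin (2 * k) → Bool) (E' := fun _ => False)
      fun ω hω => hω fun _ => ?_).trans (by simp [uprob])
    refine (StreamAlg.result_ofState insertionCode_injective ω S).trans ?_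
    rw [foldl_insertionStep hX s (e ω) hS.2]
    rfl

end insertion

theorem theorem2 :
    ∃ C : ℝ, 0 < C ∧ ∀ n m : ℕ, 2 ≤ n → n ≤ m →
      (∃ A : ℝ → StreamAlg n (SampleReport n),
        ∀ (g : ℕ → ℝ) (ε : ℝ), IsDecreasingFn g → 0 < ε → ε ≤ 1 →
          (∀ S ∈ turnstileStreams n m,
            ((A ((sigma ε g m n : ℝ) / ε)).storage S : ℝ) ≤
              C * (ε⁻¹ * (sigma ε g m n : ℝ) * Real.log n ^ 2 * Real.log (maxFreq S))) ∧
          IsApproxAlg ((A ((sigma ε g m n : ℝ) / ε)).mapOutput fun R => R.estimate g) g ε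
            (turnstileStreams n m) ∧
          IsUniversalSketch (A ((sigma ε g m n : ℝ) / ε)) m ((sigma ε g m n : ℝ) / ε) C
            (turnstileStreams n m)) ∧
      (∃ A : ℝ → StreamAlg n (SampleReport n),
        ∀ (g : ℕ → ℝ) (ε : ℝ), IsDecreasingFn g → 0 < ε → ε ≤ 1 →
          (∀ S ∈ insertionStreams n m,
            ((A ((sigma ε g m n : ℝ) / ε)).storage S : ℝ) ≤
              C * (ε⁻¹ * (sigma ε g m n : ℝ) * Real.log (maxFreq S) + Real.log n ^ 2)) ∧
          IsApproxAlg ((A ((sigma ε g m n : ℝ) / ε)).mapOutput fun R => R.estimate g) g ε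
            (insertionStreams n m) ∧
          IsUniversalSketch (A ((sigma ε g m n : ℝ) / ε)) m ((sigma ε g m n : ℝ) / ε) C
            (insertionStreams n m)) := by
  refine ⟨10 ^ 7, by norm_num, fun n m hn hm => ?_⟩
  have hr : ∀ (g : ℕ → ℝ) (ε : ℝ), IsDecreasingFn g → 0 < ε → ε ≤ 1 →
      1 ≤ (sigma ε g m n : ℝ) / ε := by
    intro g ε hg hε hε1
    have : (1 : ℝ) ≤ sigma ε g m n := by
      exact_mod_cast one_le_sigma hg hε hε1 (by omega) (by omega)
    rw [le_div_iff₀ hε]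
    linarith
  -- The sketches exist for `r ≥ 1`; the family over all reals uses `max 1 r`, which equals `r` at
  -- every rate `σ/ε`.
  choose A hA using fun r : {r : ℝ // 1 ≤ r} => exists_turnstile_sketch hn hm r.2
  choose B hB using fun r : {r : ℝ // 1 ≤ r} => exists_insertion_sketch hn hm r.2
  have hmax : ∀ r : ℝ, 1 ≤ max 1 r := fun r => le_max_left 1 r
  refine ⟨⟨fun r => A ⟨max 1 r, hmax r⟩, fun g ε hg hε hε1 => ?_⟩,
    ⟨fun r => B ⟨max 1 r, hmax r⟩, fun g ε hg hε hε1 => ?_⟩⟩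
  · obtain ⟨h1, h2⟩ := hA ⟨max 1 ((sigma ε g m n : ℝ) / ε), hmax _⟩
    simp only [max_eq_right (hr g ε hg hε hε1)] at h1 h2 ⊢
    refine ⟨fun S _ => ?_, h2.2 g ε hg hε hε1 le_rfl, h2⟩
    rw [inv_mul_eq_div]
    exact h1 S
  · obtain ⟨h1, h2⟩ := hB ⟨max 1 ((sigma ε g m n : ℝ) / ε), hmax _⟩
    simp only [max_eq_right (hr g ε hg hε hε1)] at h1 h2 ⊢
    refine ⟨fun S hS => ?_, h2.2 g ε hg hε hε1 le_rfl, h2⟩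
    rw [inv_mul_eq_div]
    exact h1 S hS
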